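/- Let $G$ be a finite simple graph with vertex set $V(G)$ and edge set $E(G)$. Let $\Phi=(G,\varphi)$ be a complex unit gain graph on $G$: $\varphi$ assigns to each oriented edge $\vec{uv}$ of $G$ a complex number $\varphi(\vec{uv})$ of modulus $1$, with $\varphi(\vec{vu})=\varphi(\vec{uv})^{-1}$. Let $r(G)$ be the rank of the adjacency matrix of $G$, let $r(\Phi)$ be the rank of the Hermitian matrix $A(\Phi)=(a_{uv})$ with $a_{uv}=\varphi(\vec{uv})$ if $uv\in E(G)$ and $a_{uv}=0$ otherwise, and let $\theta(G)=|E(G)|-|V(G)|+\omega(G)$, where $\omega(G)$ is the number of connected components of $G$. Call $\Phi$ lower-optimal if $r(\Phi)=r(G)-2\theta(G)$. Let $\mathcal C(G)$ be the set of cycles of $G$. A cycle $v_1v_2\cdots v_pv_1$ of $G$ is of Type A (in $\Phi$) if $p$ is even and $\varphi(\vec{v_1v_2})\varphi(\vec{v_2v_3})\cdots\varphi(\vec{v_{p-1}v_p})\varphi(\vec{v_pv_1})=(-1)^{p/2}$. If the cycles of $G$ are pairwise vertex-disjoint, let $T_G$ be the simple graph obtained from $G$ by contracting each cycle $O\in\mathcal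 C(G)$ to a single vertex $t_O$. That is, its vertices are the vertices of $G$ lying on no cycle together with the vertices $t_O$ for $O\in\mathcal C(G)$; two vertices on no cycle are adjacent in $T_G$ iff they are adjacent in $G$; a vertex $u$ on no cycle is adjacent to $t_O$ iff $u$ is adjacent in $G$ to a vertex of $O$; and, for $O_1\ne O_2$, $t_{O_1}$ and $t_{O_2}$ are adjacent iff some edge of $G$ joins a vertex of $O_1$ to a vertex of $O_2$. Let $\Gamma_G$ be the graph obtained from $T_G$ by deleting all the vertices $t_O$ and their incident edges. **Theorem.** If $\Phi$ is lower-optimal, then: (a) any two distinct cycles of $G$ are vertex-disjoint; (b) every cycle of $G$ is of Type A and has length $p\equiv 2\pmod 4$; (c) $r(G)=r(T_G)+\sum_{O\in\mathcal C(G)}|V(O)|$ and $r(T_G)=r(\Gamma_G)$. -/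

import Mathlib

/-- A complex unit gain graph (`𝕋`-gain graph) on the vertex set `V`: a simple graph together with
a gain in the circle group for each oriented edge, reversing an edge inverting its gain. -/
structure GainGraph (V : Type*) where
  /-- The underlying graph. -/
  graph : SimpleGraph V
  /-- The gain of an oriented edge. -/
  gain : graph.Dart → Circle
  gain_symm : ∀ d : graph.Dart, gain d.symm = (gain d)⁻¹

namespace SimpleGraph

variable {V : Type*}

open Classical in
/-- The rank `r(G)` of a finite graph: the rank of its (real) adjacency matrix. -/
noncomputable def adjRank [Finite V] (G : SimpleGraph V) : ℕ :=
  letI := Fintype.ofFinite V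
  (G.adjMatrix ℝ).rank

/-- The dimension of the cycle space `θ(G) = |E(G)| - |V(G)| + ω(G)` of a finite graph,
where `ω(G)` is the number of connected components. -/
noncomputable def cyclomaticNumber (G : SimpleGraph V) : ℤ :=
  (Nat.card G.edgeSet : ℤ) - (Nat.card V : ℤ) + (Nat.card G.ConnectedComponent : ℤ)

/-- The set `𝒞(G)` of cycles of `G`, a cycle being regarded as a subgraph (so that neither the
starting point nor the direction of traversal matters). -/
def cycleSet (G : SimpleGraph V) : Set G.Subgraph :=
  {O | ∃ (v : V) (w : G.Walk v v), w.IsCycle ∧ w.toSubgraph = O}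

/-- The set `U` of vertices of `G` that do not lie on any cycle. -/
def offCycles (G : SimpleGraph V) : Set V :=
  {u | ∀ O ∈ G.cycleSet, u ∉ O.verts}

/-- The adjacency relation of the graph obtained by contracting each cycle. -/
def contractAdj (G : SimpleGraph V) : (G.offCycles ⊕ G.cycleSet) → (G.offCycles ⊕ G.cycleSet) → Prop
  | .inl u₁, .inl u₂ => G.Adj u₁ u₂
  | .inl u, .inr O => ∃ x ∈ O.1.verts, G.Adj u x
  | .inr O, .inl u => ∃ x ∈ O.1.verts, G.Adj u x
  | .inr O₁, .inr O₂ => O₁ ≠ O₂ ∧ ∃ x ∈ O₁.1.verts, ∃ y ∈ O₂.1.verts, G.Adj x y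

/-- The graph `T_G` obtained from a graph `G` with pairwise vertex-disjoint cycles by contracting
each cycle `O` into a vertex `t_O = Sum.inr O`; the other vertices are those on no cycle. -/
def contractCycles (G : SimpleGraph V) : SimpleGraph (G.offCycles ⊕ G.cycleSet) where
  Adj := G.contractAdj
  symm := ⟨by
    rintro (u | O) (u' | O') h
    · exact G.adj_symm h
    · exact h
    · exact h
    · obtain ⟨hne, x, hx, y, hy, hxy⟩ := h
      exact ⟨hne.symm, y, hy, x, hx, hxy.symm⟩⟩
  loopless := ⟨by
    rintro (u | O) h
    · exact G.loopless.irrefl _ h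
    · exact h.1 rfl⟩

/-- The set `C_G` of the vertices `t_O` of `T_G`. -/
def contractedVerts (G : SimpleGraph V) : Set (G.offCycles ⊕ G.cycleSet) :=
  Set.range Sum.inr

/-- The graph `Γ_G` obtained from `T_G` by deleting the vertices `t_O` and their incident edges. -/
def contractCyclesDelete (G : SimpleGraph V) : SimpleGraph ↥(G.contractedVertsᶜ) :=
  G.contractCycles.induce G.contractedVertsᶜ

end SimpleGraph

namespace GainGraph

variable {V : Type*}

open Classical in
/-- The Hermitian adjacency matrix `A(Φ)`. -/
noncomputable def adjMatrix (Φ : GainGraph V) : Matrix V V ℂ :=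
  Matrix.of fun u v => if h : Φ.graph.Adj u v then (Φ.gain ⟨(u, v), h⟩ : ℂ) else 0

/-- The rank `r(Φ)` of a finite gain graph: the rank of its adjacency matrix. -/
noncomputable def rank [Finite V] (Φ : GainGraph V) : ℕ :=
  letI := Fintype.ofFinite V
  Φ.adjMatrix.rank

/-- `Φ` is lower-optimal if `r(Φ) = r(G) - 2 θ(G)`. -/
def LowerOptimal [Finite V] (Φ : GainGraph V) : Prop :=
  (Φ.rank : ℤ) = (Φ.graph.adjRank : ℤ) - 2 * Φ.graph.cyclomaticNumber

/-- The gain of a walk: the product of the gains of its oriented edges. -/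
noncomputable def walkGain (Φ : GainGraph V) {u v : V} (w : Φ.graph.Walk u v) : Circle :=
  (w.darts.map Φ.gain).prod

/-- A cycle `w` of length `n` is of Type A if `n` is even and its gain is `(-1) ^ (n / 2)`. -/
def IsTypeA (Φ : GainGraph V) {v : V} (w : Φ.graph.Walk v v) : Prop :=
  Even w.length ∧ (Φ.walkGain w : ℂ) = (-1) ^ (w.length / 2)

end GainGraph

/-! Write η for the nullity. Let H be a spanning forest of G and S a set of at most |E(G) \ E(H)|
vertices meeting every edge outside H. Off S only forest edges remain, so the gains there are a
coboundary and η(Φ - S) = η(G - S). Deleting S changes each nullity by at most |S|, so η(Φ) ≤ |S| +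
η(Φ - S) = |S| + η(G - S) ≤ 2|S| + η(G) ≤ 2θ(G) + η(G). Lower-optimality says that the two ends
agree, so every inequality is an equality. `LowerOptimal.of_spanning_forest` reads this off as
statements about kernel vectors; everything else is extracted from it by choosing H and S.

If two cycles met, two non-forest edges could be covered by one vertex, making |S| too small; hence
(a). Now S may be any choice of one vertex per cycle (`LowerOptimal.of_transversal`), and the
resulting kernel vectors can be compared across bridges (`bridge_pairing`). This shows that distinct
cycles are not adjacent, and that for each off-cycle neighbour w of a cycle the equation A y = e_w
has a solution supported off the cycles and vanishing at all such neighbours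
(`LowerOptimal.exists_solution_offCycles`). Pairing with y forces kernel vectors to vanish at these
neighbours, which decouples the cycles from the rest. Solving the recurrence around one cycle gives
(b). For (c), decoupling gives η(G) = η(Γ_G) and η(T_G) = η(Γ_G) + |𝒞(G)|. -/

open Module

/-! ### Dimension counts for maps to coordinate spaces -/

section LinearAlgebra

theorem Submodule.finrank_map_add_finrank_inf_ker {K E F : Type*} [Field K] [AddCommGroup E]
    [Module K E] [AddCommGroup F] [Module K F] [FiniteDimensional K E]
    (W : Submodule K E) (f : E →ₗ[K] F) :
    finrank K (W.map f) + finrank K (W ⊓ LinearMap.ker f : Submodule K E) = finrank K W := by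
  have h := LinearMap.finrank_range_add_finrank_ker (f.domRestrict W)
  rw [LinearMap.range_domRestrict, LinearMap.ker_domRestrict] at h
  rw [← h]
  congr 1
  have h2 := Submodule.finrank_map_subtype_eq W ((LinearMap.ker f).comap W.subtype)
  rw [Submodule.map_comap_subtype] at h2
  rw [h2]

theorem Submodule.finrank_le_of_inf_ker_le {K E ι : Type*} [Field K] [AddCommGroup E]
    [Module K E] [FiniteDimensional K E] {S : Set ι} (hS : S.Finite) (W L : Submodule K E)
    (f : E →ₗ[K] (S → K)) (h : W ⊓ LinearMap.ker f ≤ L) :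
    finrank K W ≤ S.ncard + finrank K L := by
  have := hS.fintype
  have h1 := W.finrank_map_add_finrank_inf_ker f
  have h2 := Submodule.finrank_mono h
  have h3 := Submodule.finrank_le (W.map f)
  rw [Module.finrank_fintype_fun_eq_card, ← Nat.card_eq_fintype_card, Nat.card_coe_set_eq] at h3
  omega

/-- Rank–nullity for f on W bounds the image by |S| and the kernel part by dim L; equality in the
sum leaves no slack in either term. -/
theorem Submodule.eq_of_finrank_eq_of_inf_ker_le {K E ι : Type*} [Field K] [AddCommGroup E]
    [Module K E] [FiniteDimensional K E] {S : Set ι} (hS : S.Finite) (W L : Submodule K E)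
    (f : E →ₗ[K] (S → K)) (h : W ⊓ LinearMap.ker f ≤ L)
    (heq : finrank K W = S.ncard + finrank K L) :
    W.map f = ⊤ ∧ W ⊓ LinearMap.ker f = L := by
  have := hS.fintype
  have h1 := W.finrank_map_add_finrank_inf_ker f
  have h2 := Submodule.finrank_mono h
  have h3 := Submodule.finrank_le (W.map f)
  have h4 : finrank K (S → K) = S.ncard := by
    rw [Module.finrank_fintype_fun_eq_card, ← Nat.card_eq_fintype_card, Nat.card_coe_set_eq]
  exact ⟨Submodule.eq_top_of_finrank_eq (by omega),
    Submodule.eq_of_le_of_finrank_eq h (by omega)⟩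

theorem Submodule.finrank_eq_of_map_eq_top {K E ι : Type*} [Field K] [AddCommGroup E]
    [Module K E] [FiniteDimensional K E] {S : Set ι} (hS : S.Finite) (W L : Submodule K E)
    (f : E →ₗ[K] (S → K)) (h : W ⊓ LinearMap.ker f = L) (htop : W.map f = ⊤) :
    finrank K W = S.ncard + finrank K L := by
  have := hS.fintype
  have h1 := W.finrank_map_add_finrank_inf_ker f
  rw [htop, finrank_top, h, Module.finrank_fintype_fun_eq_card, ← Nat.card_eq_fintype_card,
    Nat.card_coe_set_eq] at h1
  exact h1.symm

theorem Submodule.map_eq_top_of_forall_single {K ι : Type*} [Field K] [Finite ι] {S : Set ι}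
    [DecidableEq S] {E : Type*} [AddCommGroup E] [Module K E] (W : Submodule K E) (f : E →ₗ[K] (S → K))
    (h : ∀ s : S, ∃ y ∈ W, ∀ t : S, f y t = if t = s then 1 else 0) : W.map f = ⊤ := by
  classical
  have := Fintype.ofFinite S
  rw [eq_top_iff, ← (Pi.basisFun K S).span_eq, Submodule.span_le]
  rintro _ ⟨s, rfl⟩
  obtain ⟨y, hy, hys⟩ := h s
  refine ⟨y, hy, ?_⟩
  ext t
  rw [hys, Pi.basisFun_apply, Pi.single_apply]

end LinearAlgebra

/-! ### Kernels of principal submatrices, inside one ambient space -/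

namespace Matrix

variable {V : Type*} [Fintype V]

/-- The vectors supported on `X` that are annihilated by the principal submatrix of `M` with rows
and columns in `X`. -/
def localKer (M : Matrix V V ℂ) (X : Set V) : Submodule ℂ (V → ℂ) where
  carrier := {x | (∀ v ∉ X, x v = 0) ∧ ∀ v ∈ X, (M *ᵥ x) v = 0}
  add_mem' := by
    rintro x y ⟨h1, h2⟩ ⟨h3, h4⟩
    refine ⟨fun v hv => ?_, fun v hv => ?_⟩
    · simp [h1 v hv, h3 v hv]
    · simp [mulVec_add, h2 v hv, h4 v hv]
  zero_mem' := by simp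
  smul_mem' := by
    rintro c x ⟨h1, h2⟩
    refine ⟨fun v hv => ?_, fun v hv => ?_⟩
    · simp [h1 v hv]
    · simp [mulVec_smul, h2 v hv]

theorem mem_localKer {M : Matrix V V ℂ} {X : Set V} {x : V → ℂ} :
    x ∈ M.localKer X ↔ (∀ v ∉ X, x v = 0) ∧ ∀ v ∈ X, (M *ᵥ x) v = 0 := Iff.rfl

theorem mem_localKer_univ {M : Matrix V V ℂ} {x : V → ℂ} :
    x ∈ M.localKer Set.univ ↔ M *ᵥ x = 0 := by
  simp [mem_localKer, funext_iff]

theorem rank_add_finrank_localKer (M : Matrix V V ℂ) :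
    M.rank + finrank ℂ (M.localKer Set.univ) = Nat.card V := by
  have h := LinearMap.finrank_range_add_finrank_ker M.mulVecLin
  rw [Module.finrank_fintype_fun_eq_card, ← Nat.card_eq_fintype_card] at h
  have : M.localKer Set.univ = LinearMap.ker M.mulVecLin := by
    ext x
    rw [mem_localKer_univ, LinearMap.mem_ker, mulVecLin_apply]
  rw [← h, Matrix.rank, this]

theorem submatrix_mulVec_restrict (M : Matrix V V ℂ) {X : Set V} [Fintype X] {x : V → ℂ}
    (hx : ∀ v ∉ X, x v = 0) (v : X) :
    (M.submatrix ((↑) : X → V) (↑) *ᵥ fun w : X => x w) v = (M *ᵥ x) v := by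
  classical
  simp only [mulVec, dotProduct, submatrix_apply]
  rw [Finset.sum_set_coe (s := X) (f := fun w => M v w * x w)]
  refine Finset.sum_subset (Finset.subset_univ _) fun w _ hw => ?_
  rw [hx w (by simpa using hw), mul_zero]

open Classical in
/-- Restriction to `X` identifies the local kernel with the kernel of the principal submatrix. -/
noncomputable def localKerEquiv (M : Matrix V V ℂ) (X : Set V) [Fintype X] :
    M.localKer X ≃ₗ[ℂ] (M.submatrix ((↑) : X → V) (↑)).localKer Set.univ where
  toFun x := ⟨fun v => x.1 v, by
    rw [mem_localKer_univ]
    ext v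
    rw [submatrix_mulVec_restrict M x.2.1, x.2.2 v v.2, Pi.zero_apply]⟩
  map_add' _ _ := rfl
  map_smul' _ _ := rfl
  invFun x := ⟨fun v => if h : v ∈ X then x.1 ⟨v, h⟩ else 0, by
    have h0 : ∀ v ∉ X, (if h : v ∈ X then x.1 ⟨v, h⟩ else 0) = 0 := fun v hv => by simp [hv]
    refine ⟨h0, fun v hv => ?_⟩
    rw [← submatrix_mulVec_restrict M h0 ⟨v, hv⟩]
    simpa using x.2.2 ⟨v, hv⟩ trivial⟩
  left_inv x := by
    ext v
    by_cases h : v ∈ X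
    · simp [h]
    · simp [h, x.2.1 v h]
  right_inv x := by ext v; simp

theorem rank_submatrix_add_finrank_localKer (M : Matrix V V ℂ) (X : Set V) [Fintype X] :
    (M.submatrix ((↑) : X → V) ((↑) : X → V)).rank + finrank ℂ (M.localKer X) = X.ncard := by
  rw [(M.localKerEquiv X).finrank_eq, rank_add_finrank_localKer, Nat.card_coe_set_eq]

/-- The complex kernel of a real matrix splits into real and imaginary parts, so its real dimension
is twice that of the real kernel. This lets G and Φ be compared over ℂ. -/
theorem rank_map_ofReal (M : Matrix V V ℝ) : (M.map ((↑) : ℝ → ℂ)).rank = M.rank := by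
  have h1 := LinearMap.finrank_range_add_finrank_ker M.mulVecLin
  have h2 := LinearMap.finrank_range_add_finrank_ker (M.map ((↑) : ℝ → ℂ)).mulVecLin
  rw [Module.finrank_fintype_fun_eq_card] at h1 h2
  have key (x : V → ℂ) : (M.map ((↑) : ℝ → ℂ)) *ᵥ x = 0 ↔
      M *ᵥ (fun i => (x i).re) = 0 ∧ M *ᵥ (fun i => (x i).im) = 0 := by
    simp only [funext_iff, mulVec, dotProduct, map_apply, Pi.zero_apply, Complex.ext_iff,
      Complex.re_sum, Complex.im_sum, Complex.re_ofReal_mul, Complex.im_ofReal_mul,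
      Complex.zero_re, Complex.zero_im, forall_and]
  let e : LinearMap.ker (M.map ((↑) : ℝ → ℂ)).mulVecLin ≃ₗ[ℝ]
      LinearMap.ker M.mulVecLin × LinearMap.ker M.mulVecLin :=
    { toFun := fun x => (⟨fun i => (x.1 i).re, ((key x.1).1 x.2).1⟩,
        ⟨fun i => (x.1 i).im, ((key x.1).1 x.2).2⟩)
      map_add' := fun x y => by ext <;> simp
      map_smul' := fun c x => by ext <;> simp
      invFun := fun y => ⟨fun i => ⟨y.1.1 i, y.2.1 i⟩, (key _).2 ⟨y.1.2, y.2.2⟩⟩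
      left_inv := fun x => rfl
      right_inv := fun y => rfl }
  have h3 := e.finrank_eq
  rw [finrank_real_of_complex, Module.finrank_prod] at h3
  rw [Matrix.rank, Matrix.rank]
  omega

end Matrix

/-! ### Ranks of graphs as complex nullities -/

namespace SimpleGraph

variable {V : Type*}

open Classical in
/-- The adjacency matrix with complex entries. -/
noncomputable def cAdj (G : SimpleGraph V) : Matrix V V ℂ :=
  Matrix.of fun u v => if G.Adj u v then 1 else 0

theorem adjRank_eq_rank_cAdj [Fintype V] (G : SimpleGraph V) : G.adjRank = G.cAdj.rank := by
  classical
  have h : (Fintype.ofFinite V) = ‹Fintype V› := Subsingleton.elim _ _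
  rw [adjRank, h, ← Matrix.rank_map_ofReal]
  congr 1
  ext u v
  by_cases huv : G.Adj u v <;> simp [cAdj, adjMatrix_apply, huv]

theorem adjRank_add_finrank [Fintype V] (G : SimpleGraph V) :
    G.adjRank + finrank ℂ (G.cAdj.localKer Set.univ) = Nat.card V := by
  rw [adjRank_eq_rank_cAdj, Matrix.rank_add_finrank_localKer]

theorem adjRank_induce_add_finrank [Fintype V] (G : SimpleGraph V) (X : Set V) :
    (G.induce X).adjRank + finrank ℂ (G.cAdj.localKer X) = X.ncard := by
  have := Fintype.ofFinite X
  rw [adjRank_eq_rank_cAdj, ← G.cAdj.rank_submatrix_add_finrank_localKer X]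
  rfl

theorem adjRank_congr {W : Type*} [Finite V] [Finite W] {G : SimpleGraph V} {H : SimpleGraph W}
    (e : G ≃g H) : G.adjRank = H.adjRank := by
  have := Fintype.ofFinite V
  have := Fintype.ofFinite W
  rw [adjRank_eq_rank_cAdj, adjRank_eq_rank_cAdj, ← Matrix.rank_reindex e.toEquiv e.toEquiv]
  congr 1
  ext u v
  have h : G.Adj (e.symm u) (e.symm v) ↔ H.Adj u v := e.symm.map_adj_iff
  by_cases h' : H.Adj u v
  · exact (if_pos (h.2 h')).trans (if_pos h').symm
  · exact (if_neg (mt h.1 h')).trans (if_neg h').symm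

end SimpleGraph

theorem GainGraph.rank_add_finrank {V : Type*} [Fintype V] (Φ : GainGraph V) :
    Φ.rank + finrank ℂ (Φ.adjMatrix.localKer Set.univ) = Nat.card V := by
  have h : (Fintype.ofFinite V) = ‹Fintype V› := Subsingleton.elim _ _
  rw [GainGraph.rank, h, Matrix.rank_add_finrank_localKer]

/-! ### Nullity under vertex deletion, with equality cases -/

namespace Matrix

variable {V : Type*} [Fintype V]

/-- The map is restriction to S: a kernel vector vanishing on S is a local kernel vector of the
complement. -/
theorem finrank_localKer_univ_le (M : Matrix V V ℂ) (S : Set V) :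
    finrank ℂ (M.localKer Set.univ) ≤ S.ncard + finrank ℂ (M.localKer Sᶜ) := by
  refine Submodule.finrank_le_of_inf_ker_le S.toFinite _ _
    (LinearMap.funLeft ℂ ℂ ((↑) : S → V)) ?_
  rintro x ⟨h1, h2⟩
  exact ⟨fun v hv => congrFun h2 ⟨v, by simpa using hv⟩, fun v _ => h1.2 v trivial⟩

theorem of_finrank_localKer_univ_eq (M : Matrix V V ℂ) [DecidableEq V] (S : Set V)
    (h : finrank ℂ (M.localKer Set.univ) = S.ncard + finrank ℂ (M.localKer Sᶜ)) :
    (∀ x ∈ M.localKer Sᶜ, M *ᵥ x = 0) ∧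
      ∀ s ∈ S, ∃ y, M *ᵥ y = 0 ∧ ∀ t ∈ S, y t = if t = s then 1 else 0 := by
  obtain ⟨h1, h2⟩ := Submodule.eq_of_finrank_eq_of_inf_ker_le S.toFinite
    (M.localKer Set.univ) (M.localKer Sᶜ) (LinearMap.funLeft ℂ ℂ ((↑) : S → V)) (by
      rintro x ⟨h1, h2⟩
      exact ⟨fun v hv => congrFun h2 ⟨v, by simpa using hv⟩, fun v _ => h1.2 v trivial⟩) h
  refine ⟨fun x hx => ?_, fun s hs => ?_⟩
  · rw [← h2] at hx
    exact mem_localKer_univ.1 hx.1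
  · obtain ⟨y, hy, hys⟩ : (fun t : S => if (t : V) = s then (1 : ℂ) else 0) ∈
        (M.localKer Set.univ).map (LinearMap.funLeft ℂ ℂ ((↑) : S → V)) := h1 ▸ trivial
    exact ⟨y, mem_localKer_univ.1 hy, fun t ht => congrFun hys ⟨t, ht⟩⟩

theorem finrank_localKer_univ_eq (M : Matrix V V ℂ) [DecidableEq V] (S : Set V)
    (h : ∀ x ∈ M.localKer Sᶜ, M *ᵥ x = 0)
    (h' : ∀ s ∈ S, ∃ y, M *ᵥ y = 0 ∧ ∀ t ∈ S, y t = if t = s then 1 else 0) :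
    finrank ℂ (M.localKer Set.univ) = S.ncard + finrank ℂ (M.localKer Sᶜ) := by
  refine Submodule.finrank_eq_of_map_eq_top S.toFinite _ _
    (LinearMap.funLeft ℂ ℂ ((↑) : S → V)) (le_antisymm ?_ ?_)
    (Submodule.map_eq_top_of_forall_single _ _ fun s => ?_)
  · rintro x ⟨h1, h2⟩
    exact ⟨fun v hv => congrFun h2 ⟨v, by simpa using hv⟩, fun v _ => h1.2 v trivial⟩
  · intro x hx
    exact ⟨mem_localKer_univ.2 (h x hx), funext fun s => hx.1 s (by simp)⟩
  · obtain ⟨y, hy, hys⟩ := h' s s.2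
    refine ⟨y, mem_localKer_univ.2 hy, fun t => ?_⟩
    simp [LinearMap.funLeft_apply, hys t t.2, Subtype.ext_iff]

/-- The map is x ↦ (M x)|_S: once these values vanish too, a local kernel vector of the complement
is a kernel vector. -/
theorem finrank_localKer_compl_le (M : Matrix V V ℂ) (S : Set V) :
    finrank ℂ (M.localKer Sᶜ) ≤ S.ncard + finrank ℂ (M.localKer Set.univ) := by
  refine Submodule.finrank_le_of_inf_ker_le S.toFinite _ _
    (LinearMap.funLeft ℂ ℂ ((↑) : S → V) ∘ₗ M.mulVecLin) ?_
  rintro x ⟨h1, h2⟩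
  refine ⟨by simp, fun v _ => ?_⟩
  by_cases hv : v ∈ S
  · exact congrFun h2 ⟨v, hv⟩
  · exact h1.2 v hv

theorem of_finrank_localKer_compl_eq (M : Matrix V V ℂ) [DecidableEq V] (S : Set V)
    (h : finrank ℂ (M.localKer Sᶜ) = S.ncard + finrank ℂ (M.localKer Set.univ)) :
    (∀ x, M *ᵥ x = 0 → ∀ s ∈ S, x s = 0) ∧
      ∀ s ∈ S, ∃ x, M *ᵥ x = Pi.single s 1 ∧ ∀ t ∈ S, x t = 0 := by
  obtain ⟨h1, h2⟩ := Submodule.eq_of_finrank_eq_of_inf_ker_le S.toFinite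
    (M.localKer Sᶜ) (M.localKer Set.univ)
    (LinearMap.funLeft ℂ ℂ ((↑) : S → V) ∘ₗ M.mulVecLin) (by
      rintro x ⟨h1, h2⟩
      refine ⟨by simp, fun v _ => ?_⟩
      by_cases hv : v ∈ S
      · exact congrFun h2 ⟨v, hv⟩
      · exact h1.2 v hv) h
  refine ⟨fun x hx s hs => ?_, fun s hs => ?_⟩
  · rw [← mem_localKer_univ, ← h2] at hx
    exact hx.1.1 s (by simpa using hs)
  · obtain ⟨x, hx, hxs⟩ : (fun t : S => if (t : V) = s then (1 : ℂ) else 0) ∈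
        (M.localKer Sᶜ).map (LinearMap.funLeft ℂ ℂ ((↑) : S → V) ∘ₗ M.mulVecLin) :=
      h1 ▸ trivial
    refine ⟨x, ?_, fun t ht => hx.1 t (by simpa using ht)⟩
    ext v
    by_cases hv : v ∈ S
    · rw [Pi.single_apply]
      exact congrFun hxs ⟨v, hv⟩
    · rw [hx.2 v hv, Pi.single_eq_of_ne (by rintro rfl; exact hv hs)]

/-- Conjugation by an invertible diagonal matrix identifies local kernels. -/
noncomputable def localKerGauge {M N : Matrix V V ℂ} {X : Set V} (U W : V → ℂ) (hU : ∀ v, U v ≠ 0)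
    (hW : ∀ v, W v ≠ 0) (h : ∀ u ∈ X, ∀ v ∈ X, M u v * U v = W u * N u v) :
    N.localKer X ≃ₗ[ℂ] M.localKer X :=
  have key (x : V → ℂ) (hx : ∀ v ∉ X, x v = 0) (u : V) (hu : u ∈ X) :
      (M *ᵥ (U * x)) u = W u * (N *ᵥ x) u := by
    simp only [mulVec, dotProduct, Finset.mul_sum, Pi.mul_apply]
    refine Finset.sum_congr rfl fun v _ => ?_
    by_cases hv : v ∈ X
    · rw [← mul_assoc, h u hu v hv, mul_assoc]
    · simp [hx v hv]
  { toFun := fun x => ⟨U * x.1, fun v hv => by simp [x.2.1 v hv], fun v hv => by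
      rw [key x.1 x.2.1 v hv, x.2.2 v hv, mul_zero]⟩
    map_add' := fun x y => by ext; simp [mul_add]
    map_smul' := fun c x => by ext; simp [mul_left_comm]
    invFun := fun x =>
      have h0 : ∀ v ∉ X, (U⁻¹ * x.1) v = 0 := fun v hv => by simp [x.2.1 v hv]
      have h1 : U * (U⁻¹ * x.1) = x.1 := by ext v; simp [hU v]
      ⟨U⁻¹ * x.1, h0, fun v hv => by
        have := key _ h0 v hv
        rw [h1, x.2.2 v hv] at this
        simpa [hW v] using this.symm⟩
    left_inv := fun x => by ext v; simp [hU v]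
    right_inv := fun x => by ext v; simp [hU v] }

end Matrix

/-! ### Forests, cyclomatic number, cycles as subgraphs -/

namespace SimpleGraph

variable {V : Type*}

/-- The potential at v is the product of g along a path from the root of its component. For adjacent
u and v, uniqueness of paths makes one of the two root paths the extension of the other by that
edge. -/
theorem IsAcyclic.exists_potential {Γ : Type*} [Group Γ] {H : SimpleGraph V} (hH : H.IsAcyclic)
    (g : V → V → Γ) (hg : ∀ u v, H.Adj u v → g v u = (g u v)⁻¹) :
    ∃ U : V → Γ, ∀ u v, H.Adj u v → U v = U u * g u v := by
  classical
  let prd {u v : V} (p : H.Walk u v) : Γ := (p.darts.map fun d => g d.fst d.snd).prod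
  have hconcat {r u v : V} (p : H.Walk r u) (h : H.Adj u v) :
      prd (p.concat h) = prd p * g u v := by
    simp [prd, Walk.darts_concat]
  have key {r u v : V} (p : H.Walk r u) (q : H.Walk r v) (hp : p.IsPath) (hq : q.IsPath)
      (h : H.Adj u v) : prd q = prd p * g u v := by
    by_cases hu : u ∈ q.support
    · rw [hH.path_concat hp hq h hu, hconcat]
    · have hv := hH.mem_support_of_ne_mem_support_of_adj_of_isPath hp hq h hu
      rw [hH.path_concat hq hp h.symm hv, hconcat, hg u v h, mul_assoc, inv_mul_cancel, mul_one]
  have hroot (v : V) : ∃ p : H.Walk (H.connectedComponentMk v).out v, p.IsPath := by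
    have : H.Reachable (H.connectedComponentMk v).out v :=
      ConnectedComponent.exact (Quot.out_eq _)
    exact this.exists_isPath
  choose P hP using hroot
  refine ⟨fun v => prd (P v), fun u v h => ?_⟩
  have hc : (H.connectedComponentMk v).out = (H.connectedComponentMk u).out := by
    rw [ConnectedComponent.sound h.reachable]
  have h1 : prd ((P v).copy hc rfl) = prd (P v) := by simp [prd, Walk.darts_copy]
  refine h1.symm.trans ?_
  exact key (P u) ((P v).copy hc rfl) (hP u) (by simpa using hP v) h

theorem Reachable.of_forall_adj {G H : SimpleGraph V} (h : ∀ a b, G.Adj a b → H.Reachable a b)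
    {u v : V} (huv : G.Reachable u v) : H.Reachable u v := by
  obtain ⟨p⟩ := huv
  induction p with
  | nil => rfl
  | cons hadj _ ih => exact (h _ _ hadj).trans ih

/-- A function on V is determined by its differences along edges and its value at one representative
of each component. -/
theorem card_le_card_edgeSet_add_card_connectedComponent [Finite V] (H : SimpleGraph V) :
    Nat.card V ≤ Nat.card H.edgeSet + Nat.card H.ConnectedComponent := by
  classical
  have := Fintype.ofFinite V
  have := Fintype.ofFinite H.edgeSet
  have := Fintype.ofFinite H.ConnectedComponent
  let D : (V → ℝ) →ₗ[ℝ] (H.edgeSet → ℝ) × (H.ConnectedComponent → ℝ) :=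
    { toFun := fun x => (fun e => x e.1.out.1 - x e.1.out.2, fun c => x c.out)
      map_add' := fun x y => by ext <;> simp; ring
      map_smul' := fun c x => by ext <;> simp [mul_sub] }
  have hD : Function.Injective D := by
    rw [← LinearMap.ker_eq_bot, LinearMap.ker_eq_bot']
    intro x hx
    have h1 (u v : V) (h : H.Adj u v) : x u = x v := by
      have h2 : x (s(u, v)).out.1 - x (s(u, v)).out.2 = 0 :=
        congrFun (congrArg Prod.fst hx) ⟨s(u, v), h⟩
      have h3 : s((s(u, v)).out.1, (s(u, v)).out.2) = s(u, v) := Quot.out_eq _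
      rw [Sym2.eq_iff] at h3
      rcases h3 with ⟨h3, h4⟩ | ⟨h3, h4⟩ <;> rw [h3, h4] at h2 <;> linarith
    have h2 (u v : V) (h : H.Reachable u v) : x u = x v := by
      obtain ⟨p⟩ := h
      induction p with
      | nil => rfl
      | cons hadj _ ih => exact (h1 _ _ hadj).trans ih
    ext v
    rw [← h2 (H.connectedComponentMk v).out v (ConnectedComponent.exact (Quot.out_eq _))]
    exact congrFun (congrArg Prod.snd hx) (H.connectedComponentMk v)
  have h := LinearMap.finrank_le_finrank_of_injective hD
  simpa [Module.finrank_prod, Nat.card_eq_fintype_card] using h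

theorem ncard_edgeSet_diff_le_cyclomaticNumber [Finite V] {G H : SimpleGraph V} (hle : H ≤ G)
    (hreach : H.Reachable = G.Reachable) :
    ((G.edgeSet \ H.edgeSet).ncard : ℤ) ≤ G.cyclomaticNumber := by
  have h1 := H.card_le_card_edgeSet_add_card_connectedComponent
  have h2 : Nat.card H.ConnectedComponent = Nat.card G.ConnectedComponent :=
    Nat.card_congr (Quot.congrRight fun a b => by rw [hreach])
  have h3 := Set.ncard_sdiff_add_ncard_of_subset (edgeSet_mono hle)
  rw [cyclomaticNumber, Nat.card_coe_set_eq]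
  rw [Nat.card_coe_set_eq] at h1
  omega

theorem connected_of_mem_cycleSet {G : SimpleGraph V} {O : G.Subgraph} (hO : O ∈ G.cycleSet) :
    O.Connected := by
  obtain ⟨v, w, hw, rfl⟩ := hO
  exact w.toSubgraph_connected

theorem ncard_neighborSet_of_mem_cycleSet {G : SimpleGraph V} {O : G.Subgraph}
    (hO : O ∈ G.cycleSet) {u : V} (hu : u ∈ O.verts) : (O.neighborSet u).ncard = 2 := by
  obtain ⟨v, w, hw, rfl⟩ := hO
  exact hw.ncard_neighborSet_toSubgraph_eq_two (by simpa using hu)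

/-- Without one of its edges, a cycle still connects the ends of that edge. -/
theorem reachable_of_mem_cycleSet {G H : SimpleGraph V} {O : G.Subgraph} (hO : O ∈ G.cycleSet)
    {u v : V} (huv : O.Adj u v)
    (h : ∀ a b, O.Adj a b → s(a, b) ≠ s(u, v) → H.Reachable a b) : H.Reachable u v := by
  obtain ⟨r, w, hw, rfl⟩ := hO
  have he : ∀ e ∈ w.edges, e ∈ w.toSubgraph.spanningCoe.edgeSet := by
    rintro ⟨a, b⟩ hab
    exact (w.mem_edges_toSubgraph).2 hab
  have h1 : (w.toSubgraph.spanningCoe.deleteEdges {s(u, v)}).Reachable u v :=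
    (adj_and_reachable_delete_edges_iff_exists_cycle.2
      ⟨r, w.transfer _ he, hw.transfer he, by
        rw [Walk.edges_transfer]
        exact (w.mem_edges_toSubgraph).1 huv⟩).2
  refine Reachable.of_forall_adj (fun a b hab => ?_) h1
  rw [deleteEdges_adj] at hab
  exact h a b hab.1 (by simpa using hab.2)

theorem exists_mem_cycleSet_of_reachable_deleteEdges {G : SimpleGraph V} {u v : V}
    (huv : G.Adj u v) (h : (G.deleteEdges {s(u, v)}).Reachable u v) :
    ∃ O ∈ G.cycleSet, O.Adj u v := by
  obtain ⟨r, w, hw, he⟩ := adj_and_reachable_delete_edges_iff_exists_cycle.1 ⟨huv, h⟩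
  exact ⟨_, ⟨r, w, hw, rfl⟩, (w.mem_edges_toSubgraph).2 he⟩

theorem mem_verts_of_reachable {G : SimpleGraph V} {O : G.Subgraph} (hO : O.Connected) {X : Set V}
    {u : V} (hu : u ∈ O.verts) (hX : u ∈ X) (h : ∀ a ∈ X, ∀ b, O.Adj a b → b ∈ X) :
    O.verts ⊆ X := by
  intro v hv
  obtain ⟨p⟩ := hO.coe.preconnected ⟨u, hu⟩ ⟨v, hv⟩
  suffices ∀ a b : O.verts, O.coe.Walk a b → (a : V) ∈ X → (b : V) ∈ X from this _ _ p hX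
  intro a b q
  induction q with
  | nil => exact id
  | cons hadj _ ih => exact fun ha => ih (h _ ha _ hadj)

/-- Both cycles are 2-regular, so containment of neighbour sets at common vertices is equality;
connectedness then spreads the agreement from u. -/
theorem eq_of_mem_cycleSet {G : SimpleGraph V} [Finite V] {O₁ O₂ : G.Subgraph}
    (h₁ : O₁ ∈ G.cycleSet)
    (h₂ : O₂ ∈ G.cycleSet) {u : V} (hu₁ : u ∈ O₁.verts) (hu₂ : u ∈ O₂.verts)
    (h : ∀ v ∈ O₁.verts, v ∈ O₂.verts → ∀ x, O₁.Adj v x → O₂.Adj v x) : O₁ = O₂ := by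
  have hnb : ∀ v ∈ O₁.verts, v ∈ O₂.verts → O₁.neighborSet v = O₂.neighborSet v := by
    intro v hv₁ hv₂
    refine Set.eq_of_subset_of_ncard_le (h v hv₁ hv₂) ?_
    rw [ncard_neighborSet_of_mem_cycleSet h₁ hv₁, ncard_neighborSet_of_mem_cycleSet h₂ hv₂]
  have hadj : ∀ v ∈ O₁.verts, v ∈ O₂.verts → ∀ x, O₁.Adj v x ↔ O₂.Adj v x :=
    fun v hv₁ hv₂ x => Set.ext_iff.1 (hnb v hv₁ hv₂) x
  have h12 : O₁.verts ⊆ O₁.verts ∩ O₂.verts :=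
    mem_verts_of_reachable (connected_of_mem_cycleSet h₁) hu₁ ⟨hu₁, hu₂⟩ fun a ha b hab =>
      ⟨hab.snd_mem, ((hadj a ha.1 ha.2 b).1 hab).snd_mem⟩
  have h21 : O₂.verts ⊆ O₁.verts ∩ O₂.verts :=
    mem_verts_of_reachable (connected_of_mem_cycleSet h₂) hu₂ ⟨hu₁, hu₂⟩ fun a ha b hab =>
      ⟨((hadj a ha.1 ha.2 b).2 hab).snd_mem, hab.snd_mem⟩
  ext a b
  · exact ⟨fun ha => (h12 ha).2, fun ha => (h21 ha).1⟩
  · exact ⟨fun hab => (hadj a hab.fst_mem (h12 hab.fst_mem).2 b).1 hab,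
      fun hab => (hadj a (h21 hab.fst_mem).1 hab.fst_mem b).2 hab⟩

end SimpleGraph

/-! ### The spanning forest argument and disjointness of cycles -/

namespace GainGraph

variable {V : Type*}

theorem adjMatrix_ne_zero_iff (Φ : GainGraph V) {u v : V} :
    Φ.adjMatrix u v ≠ 0 ↔ Φ.graph.Adj u v := by
  by_cases h : Φ.graph.Adj u v <;> simp [adjMatrix, h]

theorem gain_swap (Φ : GainGraph V) {u v : V} (h : Φ.graph.Adj u v) :
    Φ.gain ⟨(v, u), h.symm⟩ = (Φ.gain ⟨(u, v), h⟩)⁻¹ :=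
  Φ.gain_symm ⟨(u, v), h⟩

theorem adjMatrix_isHermitian (Φ : GainGraph V) : Φ.adjMatrix.IsHermitian := by
  ext u v
  by_cases h : Φ.graph.Adj u v
  · simp only [adjMatrix, Matrix.conjTranspose_apply, Matrix.of_apply, h, h.symm, dif_pos,
      Φ.gain_swap h, Circle.coe_inv_eq_conj]
    simp
  · have h' : ¬ Φ.graph.Adj v u := fun h2 => h h2.symm
    simp [adjMatrix, h, h']

/-- On an acyclic graph the gains are a coboundary. -/
theorem exists_gauge (Φ : GainGraph V) {H : SimpleGraph V} (hle : H ≤ Φ.graph)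
    (hH : H.IsAcyclic) :
    ∃ U : V → ℂ, (∀ v, U v ≠ 0) ∧ ∀ u v, H.Adj u v → Φ.adjMatrix u v * U v = U u := by
  classical
  obtain ⟨U, hU⟩ := hH.exists_potential
    (fun u v => if h : Φ.graph.Adj u v then Φ.gain ⟨(u, v), h⟩ else 1) (by
      intro u v h
      simp only [hle h, (hle h).symm, dif_pos, Φ.gain_swap (hle h)])
  refine ⟨fun v => ((U v)⁻¹ : Circle), fun v => Circle.coe_ne_zero _, fun u v h => ?_⟩
  simp only [hU u v h]
  simp only [adjMatrix, Matrix.of_apply, hle h, dif_pos]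
  rw [← Circle.coe_mul]
  simp

variable [Fintype V] [DecidableEq V]

/-- The engine of the proof: the chain of nullity inequalities is tight. The two groups of
conclusions are the equality cases of deleting S from Φ and from G. -/
theorem LowerOptimal.of_spanning_forest {Φ : GainGraph V} (hΦ : Φ.LowerOptimal)
    {H : SimpleGraph V} (hle : H ≤ Φ.graph) (hH : H.IsAcyclic)
    (hreach : H.Reachable = Φ.graph.Reachable) (S : Set V)
    (hS : ∀ u v, Φ.graph.Adj u v → ¬ H.Adj u v → u ∈ S ∨ v ∈ S)
    (hcard : S.ncard ≤ (Φ.graph.edgeSet \ H.edgeSet).ncard) :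
    S.ncard = (Φ.graph.edgeSet \ H.edgeSet).ncard ∧
      ((∀ x ∈ Φ.adjMatrix.localKer Sᶜ, Φ.adjMatrix.mulVec x = 0) ∧
        ∀ s ∈ S, ∃ y, Φ.adjMatrix.mulVec y = 0 ∧ ∀ t ∈ S, y t = if t = s then 1 else 0) ∧
      (∀ x, Φ.graph.cAdj.mulVec x = 0 → ∀ s ∈ S, x s = 0) ∧
        ∀ s ∈ S, ∃ x, Φ.graph.cAdj.mulVec x = Pi.single s 1 ∧ ∀ t ∈ S, x t = 0 := by
  obtain ⟨U, hU0, hU⟩ := Φ.exists_gauge hle hH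
  have hθ := SimpleGraph.ncard_edgeSet_diff_le_cyclomaticNumber hle hreach
  have hgauge := (Matrix.localKerGauge (M := Φ.adjMatrix) (N := Φ.graph.cAdj) (X := Sᶜ) U U hU0
    hU0 (by
      intro u hu v hv
      by_cases h : Φ.graph.Adj u v
      · have h2 : H.Adj u v := by
          by_contra h2
          rcases hS u v h h2 with h3 | h3
          · exact hu h3
          · exact hv h3
        simp [hU u v h2, SimpleGraph.cAdj, h]
      · simp [adjMatrix, SimpleGraph.cAdj, h])).finrank_eq
  have h1 := Φ.rank_add_finrank
  have h2 := Φ.graph.adjRank_add_finrank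
  have h3 := Φ.adjMatrix.finrank_localKer_univ_le S
  have h4 := Φ.graph.cAdj.finrank_localKer_compl_le S
  rw [LowerOptimal] at hΦ
  exact ⟨by omega, Φ.adjMatrix.of_finrank_localKer_univ_eq S (by omega),
    Φ.graph.cAdj.of_finrank_localKer_compl_eq S (by omega)⟩

/-- Distinct cycles with a common vertex branch at some u: an edge ux of the first is not in the
second. Deleting ux and an edge uy of the second keeps the components, yet u alone covers both
edges, contradicting tightness of |S|. -/
theorem LowerOptimal.disjoint_verts {Φ : GainGraph V} (hΦ : Φ.LowerOptimal)
    {O₁ O₂ : Φ.graph.Subgraph} (h₁ : O₁ ∈ Φ.graph.cycleSet) (h₂ : O₂ ∈ Φ.graph.cycleSet)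
    (hne : O₁ ≠ O₂) : Disjoint O₁.verts O₂.verts := by
  by_contra hdis
  obtain ⟨a, ha₁, ha₂⟩ := Set.not_disjoint_iff.1 hdis
  obtain ⟨u, hu₁, hu₂, x, hx₁, hx₂⟩ : ∃ u ∈ O₁.verts, u ∈ O₂.verts ∧ ∃ x, O₁.Adj u x ∧
      ¬ O₂.Adj u x := by
    by_contra! h
    exact hne (SimpleGraph.eq_of_mem_cycleSet h₁ h₂ ha₁ ha₂ h)
  obtain ⟨y, hy⟩ : (O₂.neighborSet u).Nonempty := by
    rw [← Set.ncard_pos, SimpleGraph.ncard_neighborSet_of_mem_cycleSet h₂ hu₂]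
    norm_num
  have hy : O₂.Adj u y := hy
  have hexy : s(u, x) ≠ s(u, y) := by
    intro h
    rw [Sym2.congr_right] at h
    exact hx₂ (h ▸ hy)
  set K := Φ.graph.deleteEdges {s(u, x), s(u, y)} with hK
  have hKadj : ∀ a b, Φ.graph.Adj a b → s(a, b) ≠ s(u, x) → s(a, b) ≠ s(u, y) →
      K.Reachable a b := fun a b hab h h' =>
    SimpleGraph.Adj.reachable (by rw [hK, SimpleGraph.deleteEdges_adj]; exact ⟨hab, by simp [h, h']⟩)
  have hcongr : ∀ {a b c d : V}, s(a, b) = s(c, d) → K.Reachable c d → K.Reachable a b := by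
    intro a b c d h hr
    rw [Sym2.eq_iff] at h
    rcases h with ⟨rfl, rfl⟩ | ⟨rfl, rfl⟩
    exacts [hr, hr.symm]
  -- The second cycle avoids ux, so it still joins u to y. The first may use uy, and is then
  -- rerouted along this connection.
  have hry : K.Reachable u y := SimpleGraph.reachable_of_mem_cycleSet h₂ hy fun a b hab h =>
    hKadj a b hab.adj_sub (fun h' => hx₂ (by
      rw [← SimpleGraph.Subgraph.mem_edgeSet, h'.symm]; exact hab)) h
  have hrx : K.Reachable u x := SimpleGraph.reachable_of_mem_cycleSet h₁ hx₁ fun a b hab h => by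
    by_cases h' : s(a, b) = s(u, y)
    · exact hcongr h' hry
    · exact hKadj a b hab.adj_sub h h'
  obtain ⟨H, hHK, hH, hreach⟩ := K.exists_isAcyclic_reachable_eq_le
  have hreach' : H.Reachable = Φ.graph.Reachable := by
    rw [hreach]
    ext a b
    refine ⟨fun h => h.mono (SimpleGraph.deleteEdges_le _), fun h => h.of_forall_adj ?_⟩
    intro a b hab
    by_cases h : s(a, b) = s(u, x)
    · exact hcongr h hrx
    · by_cases h' : s(a, b) = s(u, y)
      · exact hcongr h' hry
      · exact hKadj a b hab h h'
  -- f picks an endpoint of each edge, and picks u whenever possible, so it identifies ux with uy.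
  have hf : ∀ e : Sym2 V, ∃ v, v ∈ e ∧ (u ∈ e → v = u) := by
    intro e
    by_cases h : u ∈ e
    · exact ⟨u, h, fun _ => rfl⟩
    · exact ⟨e.out.1, Sym2.out_fst_mem e, fun h' => absurd h' h⟩
  choose f hf hfu using hf
  set E := Φ.graph.edgeSet \ H.edgeSet with hE
  have hKe : ∀ e ∈ H.edgeSet, e ≠ s(u, x) ∧ e ≠ s(u, y) := by
    intro e he
    have := SimpleGraph.edgeSet_mono hHK he
    rw [hK, SimpleGraph.edgeSet_deleteEdges] at this
    simpa using this.2
  have hlt : (f '' E).ncard < E.ncard := by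
    refine lt_of_le_of_ne (Set.ncard_image_le) fun h => ?_
    have hinj := (Set.ncard_image_iff).1 h
    refine hexy (hinj ⟨hx₁.adj_sub, fun h => (hKe _ h).1 rfl⟩
      ⟨hy.adj_sub, fun h => (hKe _ h).2 rfl⟩ ?_)
    rw [hfu _ (Sym2.mem_mk_left _ _), hfu _ (Sym2.mem_mk_left _ _)]
  have h := (hΦ.of_spanning_forest (hHK.trans (SimpleGraph.deleteEdges_le _)) hH hreach' (f '' E)
    (by
      intro a b hab hab'
      have h1 : f s(a, b) ∈ f '' E := ⟨_, ⟨hab, hab'⟩, rfl⟩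
      rcases Sym2.mem_iff.1 (hf s(a, b)) with h | h
      · exact Or.inl (h ▸ h1)
      · exact Or.inr (h ▸ h1)) hlt.le).1
  exact hlt.ne h

end GainGraph

/-! ### Bridges and the forest of vertices on no cycle -/

namespace SimpleGraph

variable {V : Type*} {G : SimpleGraph V}

theorem notMem_offCycles {u : V} : u ∉ G.offCycles ↔ ∃ O ∈ G.cycleSet, u ∈ O.verts := by
  simp [offCycles]

theorem isBridge_of_forall_cycleSet {u v : V} (h : G.Adj u v)
    (h' : ∀ O ∈ G.cycleSet, u ∈ O.verts → v ∉ O.verts) : G.IsBridge s(u, v) := by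
  rw [isBridge_iff]
  intro hr
  obtain ⟨O, hO, huv⟩ := exists_mem_cycleSet_of_reachable_deleteEdges h hr
  exact h' O hO huv.fst_mem huv.snd_mem

theorem nonempty_verts_of_mem_cycleSet {O : G.Subgraph} (hO : O ∈ G.cycleSet) :
    O.verts.Nonempty := by
  obtain ⟨v, w, hw, rfl⟩ := hO
  exact ⟨v, by simp⟩

variable (G) in
/-- The spanning subgraph whose edges are the edges between vertices on no cycle. -/
def offCyclesGraph : SimpleGraph V where
  Adj a b := G.Adj a b ∧ a ∈ G.offCycles ∧ b ∈ G.offCycles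
  symm := ⟨fun _ _ h => ⟨h.1.symm, h.2.2, h.2.1⟩⟩
  loopless := ⟨fun _ h => G.loopless.irrefl _ h.1⟩

theorem offCyclesGraph_le : G.offCyclesGraph ≤ G := fun _ _ h => h.1

theorem isAcyclic_offCyclesGraph : G.offCyclesGraph.IsAcyclic := by
  intro v w hw
  have h1 := w.adj_snd hw.not_nil
  refine h1.2.1 _ ⟨v, w.mapLe offCyclesGraph_le, hw.mapLe offCyclesGraph_le, rfl⟩ ?_
  simp

theorem mem_offCycles_of_reachable {u v : V} (hu : u ∈ G.offCycles)
    (h : G.offCyclesGraph.Reachable u v) : v ∈ G.offCycles := by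
  obtain ⟨p⟩ := h
  induction p with
  | nil => exact hu
  | cons hadj _ ih => exact ih hadj.2.2

/-- A component of the graph off the cycles is attached to a cycle by at most one edge. -/
theorem attachment_unique {w₁ w₂ v₁ v₂ : V} (hw₁ : w₁ ∈ G.offCycles)
    (hr : G.offCyclesGraph.Reachable w₁ w₂) {O : G.Subgraph} (hO : O ∈ G.cycleSet)
    (hv₁ : v₁ ∈ O.verts) (hv₂ : v₂ ∈ O.verts) (h₁ : G.Adj w₁ v₁) (h₂ : G.Adj w₂ v₂) :
    w₁ = w₂ ∧ v₁ = v₂ := by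
  by_contra hne
  have hw₂ := mem_offCycles_of_reachable hw₁ hr
  -- A second attaching edge would bypass this bridge: through the component to w₂, across to v₂,
  -- and around O to v₁.
  have hb : G.IsBridge s(w₁, v₁) :=
    isBridge_of_forall_cycleSet h₁ fun O' hO' h => absurd h (hw₁ O' hO')
  rw [isBridge_iff] at hb
  set K := G.deleteEdges {s(w₁, v₁)} with hK
  have hKadj : ∀ a b, G.Adj a b → s(a, b) ≠ s(w₁, v₁) → K.Adj a b := fun a b hab h => by
    rw [hK, deleteEdges_adj]
    exact ⟨hab, by simpa using h⟩
  have r1 : K.Reachable w₁ w₂ := by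
    refine Reachable.of_forall_adj (G := G.offCyclesGraph)
      (fun a b hab => (hKadj a b hab.1 fun h => ?_).reachable) hr
    rcases Sym2.eq_iff.1 h with ⟨-, rfl⟩ | ⟨rfl, -⟩
    · exact hab.2.2 O hO hv₁
    · exact hab.2.1 O hO hv₁
  have r2 : K.Reachable w₂ v₂ := by
    refine (hKadj _ _ h₂ fun h => ?_).reachable
    rcases Sym2.eq_iff.1 h with ⟨rfl, rfl⟩ | ⟨rfl, -⟩
    · exact hne ⟨rfl, rfl⟩
    · exact hw₂ O hO hv₁
  have r3 : K.Reachable v₂ v₁ := by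
    refine mem_verts_of_reachable (connected_of_mem_cycleSet hO) (X := {x | K.Reachable v₂ x})
      hv₂ (Reachable.refl _) (fun a ha b hab => ?_) hv₁
    refine Reachable.trans ha (hKadj _ _ hab.adj_sub fun h => ?_).reachable
    rcases Sym2.eq_iff.1 h with ⟨rfl, -⟩ | ⟨-, rfl⟩
    · exact hw₁ O hO hab.fst_mem
    · exact hw₁ O hO hab.snd_mem
  exact hb (r1.trans (r2.trans r3))

end SimpleGraph

/-! ### Kernel vectors across bridges; transversals of the cycles -/

namespace GainGraph

open SimpleGraph

variable {V : Type*}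

theorem exists_transversal (Φ : GainGraph V) :
    ∃ ρ : Φ.graph.cycleSet → V, ∀ O, ρ O ∈ O.1.verts :=
  ⟨fun O => (nonempty_verts_of_mem_cycleSet O.2).some,
    fun O => (nonempty_verts_of_mem_cycleSet O.2).some_mem⟩

variable [Fintype V]

/-- Cutting a kernel vector along a bridge gives a relation between the values of kernel vectors
at the two ends of the bridge. -/
theorem bridge_pairing (Φ : GainGraph V) {v w : V} (hvw : Φ.graph.Adj v w)
    (hb : Φ.graph.IsBridge s(v, w)) {y z : V → ℂ} (hy : Φ.adjMatrix.mulVec y = 0)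
    (hz : Φ.adjMatrix.mulVec z = 0) :
    star (z v) * (Φ.adjMatrix v w * y w) = star (z w) * (Φ.adjMatrix w v * y v) := by
  classical
  rw [isBridge_iff] at hb
  set K := Φ.graph.deleteEdges {s(v, w)} with hK
  set P : Set V := {f | K.Reachable w f} with hP
  have hwP : w ∈ P := Reachable.refl _
  have hvP : v ∉ P := fun h => hb h.symm
  have hKadj : ∀ a b, Φ.graph.Adj a b → s(a, b) ≠ s(v, w) → K.Adj a b := fun a b hab h => by
    rw [hK, deleteEdges_adj]
    exact ⟨hab, by simpa using h⟩
  -- P is the side of w. Moving the indicator of P from the column index to the row index matters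
  -- only on the bridge itself.
  have hterm (f g : V) : Φ.adjMatrix f g * P.indicator y g =
      P.indicator 1 f * (Φ.adjMatrix f g * y g) +
        (if g = w then (if f = v then Φ.adjMatrix v w * y w else 0) else 0) -
        (if g = v then (if f = w then Φ.adjMatrix w v * y v else 0) else 0) := by
    by_cases hfg : Φ.graph.Adj f g
    · by_cases he : s(f, g) = s(v, w)
      · rcases Sym2.eq_iff.1 he with ⟨rfl, rfl⟩ | ⟨rfl, rfl⟩
        · simp [hwP, hvP, hfg.ne']
        · simp [hwP, hvP, hfg.ne']
      · have hiff : f ∈ P ↔ g ∈ P :=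
          ⟨fun h => Reachable.trans h (hKadj f g hfg he).reachable,
            fun h => Reachable.trans h (hKadj f g hfg he).symm.reachable⟩
        have h1 : ¬ (g = w ∧ f = v) := by rintro ⟨rfl, rfl⟩; exact he rfl
        have h2 : ¬ (g = v ∧ f = w) := by rintro ⟨rfl, rfl⟩; exact he Sym2.eq_swap
        rw [← ite_and, ← ite_and, if_neg h1, if_neg h2]
        by_cases hf : f ∈ P
        · simp [hf, hiff.1 hf]
        · simp [hf, mt hiff.2 hf]
    · have h0 : Φ.adjMatrix f g = 0 := not_not.1 (mt Φ.adjMatrix_ne_zero_iff.1 hfg)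
      have h1 : ¬ (g = w ∧ f = v) := by rintro ⟨rfl, rfl⟩; exact hfg hvw
      have h2 : ¬ (g = v ∧ f = w) := by rintro ⟨rfl, rfl⟩; exact hfg hvw.symm
      rw [← ite_and, ← ite_and, if_neg h1, if_neg h2]
      simp [h0]
  have hsum (f : V) : Φ.adjMatrix.mulVec (P.indicator y) f =
      (if f = v then Φ.adjMatrix v w * y w else 0) -
        (if f = w then Φ.adjMatrix w v * y v else 0) := by
    have hyf : ∑ g, Φ.adjMatrix f g * y g = 0 := congrFun hy f
    simp only [Matrix.mulVec, dotProduct, hterm, Finset.sum_sub_distrib, Finset.sum_add_distrib,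
      ← Finset.mul_sum, hyf]
    simp
  -- By Hermitian symmetry the matrix moves onto z, where it gives 0.
  have hdot : star z ⬝ᵥ Φ.adjMatrix.mulVec (P.indicator y) = 0 := by
    have h1 := Φ.adjMatrix.star_mulVec z
    rw [hz, Φ.adjMatrix_isHermitian.eq, star_zero] at h1
    rw [Matrix.dotProduct_mulVec, ← h1, zero_dotProduct]
  rw [funext hsum] at hdot
  simp only [dotProduct, Pi.star_apply, mul_sub, mul_ite, mul_zero, Finset.sum_sub_distrib,
    Finset.sum_ite_eq', Finset.mem_univ, if_true] at hdot
  exact sub_eq_zero.1 hdot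

variable [DecidableEq V] {Φ : GainGraph V}

theorem LowerOptimal.eq_of_mem_verts (hΦ : Φ.LowerOptimal) {O₁ O₂ : Φ.graph.Subgraph}
    (h₁ : O₁ ∈ Φ.graph.cycleSet) (h₂ : O₂ ∈ Φ.graph.cycleSet) {v : V} (hv₁ : v ∈ O₁.verts)
    (hv₂ : v ∈ O₂.verts) : O₁ = O₂ := by
  by_contra hne
  exact Set.disjoint_left.1 (hΦ.disjoint_verts h₁ h₂ hne) hv₁ hv₂

/-- Delete from each cycle O one of its edges at ρ O. The cycles being disjoint, each loses exactly
one edge, so a spanning forest remains and the range of ρ covers the deleted edges. -/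
theorem LowerOptimal.of_transversal (hΦ : Φ.LowerOptimal) (ρ : Φ.graph.cycleSet → V)
    (hρ : ∀ O, ρ O ∈ O.1.verts) :
    ((∀ x ∈ Φ.adjMatrix.localKer (Set.range ρ)ᶜ, Φ.adjMatrix.mulVec x = 0) ∧
        ∀ s ∈ Set.range ρ, ∃ y, Φ.adjMatrix.mulVec y = 0 ∧
          ∀ t ∈ Set.range ρ, y t = if t = s then 1 else 0) ∧
      (∀ x, Φ.graph.cAdj.mulVec x = 0 → ∀ s ∈ Set.range ρ, x s = 0) ∧
        ∀ s ∈ Set.range ρ, ∃ x, Φ.graph.cAdj.mulVec x = Pi.single s 1 ∧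
          ∀ t ∈ Set.range ρ, x t = 0 := by
  have hex : ∀ O : Φ.graph.cycleSet, ∃ x, O.1.Adj (ρ O) x := by
    intro O
    have h : (O.1.neighborSet (ρ O)).Nonempty := by
      rw [← Set.ncard_pos, ncard_neighborSet_of_mem_cycleSet O.2 (hρ O)]
      norm_num
    exact h
  choose x hx using hex
  let e : Φ.graph.cycleSet → Sym2 V := fun O => s(ρ O, x O)
  have he : ∀ {O O' : Φ.graph.cycleSet} {a b : V}, O.1.Adj a b → s(a, b) = e O' → O = O' := by
    intro O O' a b hab h
    have h1 : ρ O' ∈ s(a, b) := h ▸ Sym2.mem_mk_left _ _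
    have h2 : ρ O' ∈ O.1.verts := by
      rcases Sym2.mem_iff.1 h1 with h | h
      · exact h ▸ hab.fst_mem
      · exact h ▸ hab.snd_mem
    exact Subtype.ext (hΦ.eq_of_mem_verts O.2 O'.2 h2 (hρ O'))
  have hinj : Function.Injective e := fun O O' h => he (hx O) h
  let H := Φ.graph.deleteEdges (Set.range e)
  have hle : H ≤ Φ.graph := deleteEdges_le _
  have hH : H.IsAcyclic := by
    intro v w hw
    let O : Φ.graph.cycleSet := ⟨(w.mapLe hle).toSubgraph, v, w.mapLe hle, hw.mapLe hle, rfl⟩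
    have h1 : e O ∈ (w.mapLe hle).edges := (w.mapLe hle).mem_edges_toSubgraph.1 (hx O)
    rw [Walk.edges_mapLe_eq_edges] at h1
    have h2 := w.edges_subset_edgeSet h1
    rw [edgeSet_deleteEdges] at h2
    exact h2.2 ⟨O, rfl⟩
  have hHadj : ∀ a b, Φ.graph.Adj a b → s(a, b) ∉ Set.range e → H.Adj a b := fun a b hab h => by
    rw [deleteEdges_adj]
    exact ⟨hab, h⟩
  have hreach : H.Reachable = Φ.graph.Reachable := by
    ext a b
    refine ⟨fun h => h.mono hle, fun h => h.of_forall_adj fun a b hab => ?_⟩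
    by_cases h : s(a, b) ∈ Set.range e
    · obtain ⟨O, hO⟩ := h
      have h1 : O.1.Adj a b := by
        rw [← Subgraph.mem_edgeSet, ← hO]
        exact hx O
      refine reachable_of_mem_cycleSet O.2 h1 fun c d hcd hne =>
        (hHadj c d hcd.adj_sub ?_).reachable
      rintro ⟨O', hO'⟩
      obtain rfl := he hcd hO'.symm
      exact hne (hO'.symm.trans hO)
    · exact (hHadj a b hab h).reachable
  refine (hΦ.of_spanning_forest hle hH hreach (Set.range ρ) ?_ ?_).2
  · intro u v huv h
    by_contra! hcon
    refine h (hHadj u v huv ?_)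
    rintro ⟨O, hO⟩
    have h1 : ρ O ∈ s(u, v) := hO ▸ Sym2.mem_mk_left _ _
    rcases Sym2.mem_iff.1 h1 with h | h
    · exact hcon.1 ⟨O, h⟩
    · exact hcon.2 ⟨O, h⟩
  · have h1 : Φ.graph.edgeSet \ H.edgeSet = Set.range e := by
      rw [edgeSet_deleteEdges, Set.sdiff_sdiff_cancel_left]
      rintro _ ⟨O, rfl⟩
      exact (hx O).adj_sub
    rw [h1, ← Set.image_univ, ← Set.image_univ, Set.ncard_image_of_injective _ hinj]
    exact Set.ncard_image_le

/-- An edge vw between two cycles would be a bridge. With v and w in one transversal there are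
kernel vectors with values (1, 0) and (0, 1) on (v, w), which violate `bridge_pairing`. -/
theorem LowerOptimal.not_adj_of_ne (hΦ : Φ.LowerOptimal) {O₁ O₂ : Φ.graph.Subgraph}
    (h₁ : O₁ ∈ Φ.graph.cycleSet) (h₂ : O₂ ∈ Φ.graph.cycleSet) (hne : O₁ ≠ O₂) {v w : V}
    (hv : v ∈ O₁.verts) (hw : w ∈ O₂.verts) : ¬ Φ.graph.Adj v w := by
  classical
  intro hvw
  obtain ⟨ρ₀, hρ₀⟩ := Φ.exists_transversal
  let ρ : Φ.graph.cycleSet → V := fun O => if O.1 = O₁ then v else if O.1 = O₂ then w else ρ₀ O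
  have hρ : ∀ O, ρ O ∈ O.1.verts := by
    intro O
    by_cases h : O.1 = O₁
    · simp [ρ, h, hv]
    · by_cases h' : O.1 = O₂
      · simp [ρ, h', hne.symm, hw]
      · simp [ρ, h, h', hρ₀]
  have hvρ : v ∈ Set.range ρ := ⟨⟨O₁, h₁⟩, by simp [ρ]⟩
  have hwρ : w ∈ Set.range ρ := ⟨⟨O₂, h₂⟩, by simp [ρ, hne.symm]⟩
  obtain ⟨⟨-, h⟩, -⟩ := hΦ.of_transversal ρ hρ
  obtain ⟨y, hy, hys⟩ := h v hvρ
  obtain ⟨z, hz, hzs⟩ := h w hwρ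
  have hb : Φ.graph.IsBridge s(v, w) := isBridge_of_forall_cycleSet hvw fun O hO hvO hwO =>
    hne ((hΦ.eq_of_mem_verts h₁ hO hv hvO).trans (hΦ.eq_of_mem_verts hO h₂ hwO hw))
  have hp := Φ.bridge_pairing hvw hb hy hz
  rw [hys w hwρ, hys v hvρ, hzs v hvρ, hzs w hwρ, if_pos rfl, if_pos rfl, if_neg hvw.ne,
    if_neg hvw.ne'] at hp
  exact Φ.adjMatrix_ne_zero_iff.2 hvw.symm (by simpa using hp.symm)

end GainGraph

/-! ### Decoupling the cycles from the remaining vertices -/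

namespace SimpleGraph

variable {V : Type*}

/-- The vertices on no cycle that are adjacent to some cycle. -/
def cycleBoundary (G : SimpleGraph V) : Set V :=
  {w | w ∈ G.offCycles ∧ ∃ O ∈ G.cycleSet, ∃ v ∈ O.verts, G.Adj w v}

end SimpleGraph

namespace GainGraph

open SimpleGraph

variable {V : Type*} [Fintype V] [DecidableEq V] {Φ : GainGraph V}

/-- A transversal of the cycles through all vertices where cycles are attached to the component
of `w` off the cycles. -/
theorem exists_transversal_attachment (Φ : GainGraph V) {w : V} (hw : w ∈ Φ.graph.offCycles) :
    ∃ ρ : Φ.graph.cycleSet → V, (∀ O, ρ O ∈ O.1.verts) ∧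
      ∀ (O : Φ.graph.cycleSet) (f : V), Φ.graph.offCyclesGraph.Reachable w f →
        ∀ v ∈ O.1.verts, Φ.graph.Adj f v → v = ρ O := by
  have h : ∀ O : Φ.graph.cycleSet, ∃ r ∈ O.1.verts, ∀ f, Φ.graph.offCyclesGraph.Reachable w f →
      ∀ v ∈ O.1.verts, Φ.graph.Adj f v → v = r := by
    intro O
    by_cases h : ∃ f, Φ.graph.offCyclesGraph.Reachable w f ∧ ∃ v ∈ O.1.verts, Φ.graph.Adj f v
    · obtain ⟨f, hf, v, hv, hfv⟩ := h
      exact ⟨v, hv, fun f' hf' v' hv' h' =>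
        (attachment_unique (mem_offCycles_of_reachable hw hf') (hf'.symm.trans hf) O.2 hv' hv
          h' hfv).2⟩
    · push Not at h
      exact ⟨_, (nonempty_verts_of_mem_cycleSet O.2).some_mem, fun f hf v hv hfv =>
        absurd hfv (h f hf v hv)⟩
  choose ρ hρ hρ' using h
  exact ⟨ρ, hρ, hρ'⟩

/-- Take a kernel vector equal to 1 at the attaching vertex v and 0 at the other transversal
vertices, and cut it to the off-cycle component C of w. The lost entry at v leaves a multiple of e_w
on C. -/
theorem LowerOptimal.exists_solution_offCycles (hΦ : Φ.LowerOptimal) {w : V}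
    (hw : w ∈ Φ.graph.cycleBoundary) :
    ∃ y : V → ℂ, (∀ f ∉ Φ.graph.offCycles, y f = 0) ∧ (∀ f ∈ Φ.graph.cycleBoundary, y f = 0) ∧
      Φ.adjMatrix.mulVec y = Pi.single w 1 := by
  classical
  obtain ⟨hwU, O, hO, v, hv, hwv⟩ := hw
  obtain ⟨ρ, hρ, hρ'⟩ := Φ.exists_transversal_attachment hwU
  set A := Φ.adjMatrix with hA
  have hA0 : ∀ {a b : V}, ¬ Φ.graph.Adj a b → A a b = 0 := fun h =>
    not_not.1 (mt Φ.adjMatrix_ne_zero_iff.1 h)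
  set C : Set V := {f | Φ.graph.offCyclesGraph.Reachable w f} with hC
  have hwC : w ∈ C := Reachable.refl _
  have hCU : ∀ {f}, f ∈ C → f ∈ Φ.graph.offCycles := fun hf => mem_offCycles_of_reachable hwU hf
  have hCcl : ∀ {f g}, f ∈ C → g ∉ C → Φ.graph.Adj f g → g ∉ Φ.graph.offCycles :=
    fun {f g} hf hg h hgU => hg (Reachable.trans hf (Adj.reachable ⟨h, hCU hf, hgU⟩))
  have hvρ : v = ρ ⟨O, hO⟩ := hρ' ⟨O, hO⟩ w hwC v hv hwv
  have hvS : v ∈ Set.range ρ := ⟨_, hvρ.symm⟩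
  have hSout : ∀ {f g}, f ∈ C → g ∉ C → Φ.graph.Adj f g → g ∈ Set.range ρ := by
    intro f g hf hg h
    obtain ⟨O', hO', hgO⟩ := notMem_offCycles.1 (hCcl hf hg h)
    exact ⟨⟨O', hO'⟩, (hρ' ⟨O', hO'⟩ f hf g hgO h).symm⟩
  have hCS : ∀ {f}, f ∈ C → f ∉ Set.range ρ := by
    rintro f hf ⟨O', rfl⟩
    exact hCU hf O'.1 O'.2 (hρ O')
  have hwu : ∀ {f}, f ∈ C → Φ.graph.Adj f v → f = w := fun hf h =>
    (attachment_unique (hCU hf) (Reachable.symm hf) hO hv hv h hwv).1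
  have hvC : v ∉ C := fun h => hCS h hvS
  obtain ⟨⟨hker, hsec⟩, -⟩ := hΦ.of_transversal ρ hρ
  -- Vertices outside C adjacent to C lie on the transversal, so a local kernel vector on C is one
  -- off the transversal, hence a genuine kernel vector.
  have hsupp : ∀ x : V → ℂ, (∀ f ∉ C, x f = 0) → (∀ f ∈ C, A.mulVec x f = 0) →
      A.mulVec x = 0 := by
    refine fun x hx hx' => hker x ⟨fun f hf => hx f fun h => hf (hCS h), fun f hf => ?_⟩
    by_cases hfC : f ∈ C
    · exact hx' f hfC
    · refine Finset.sum_eq_zero fun g _ => ?_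
      by_cases hg : g ∈ C
      · exact mul_eq_zero_of_left (hA0 fun h => hf (hSout hg hfC h.symm)) _
      · rw [hx g hg, mul_zero]
  obtain ⟨y₀, hy₀, hy₀S⟩ := hsec v hvS
  set y := C.indicator y₀ with hy
  have hy_off : ∀ f ∉ C, y f = 0 := fun f hf => Set.indicator_of_notMem hf _
  have hyC : ∀ f ∈ C, A.mulVec y f = if f = w then -A w v else 0 := by
    intro f hf
    have h1 : A.mulVec y f + A f v = A.mulVec y₀ f := by
      have h2 : A f v = ∑ g, if g = v then A f g else 0 := by simp
      rw [h2, Matrix.mulVec, Matrix.mulVec, dotProduct, dotProduct, ← Finset.sum_add_distrib]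
      refine Finset.sum_congr rfl fun g _ => ?_
      by_cases hg : g ∈ C
      · have hgv : g ≠ v := by rintro rfl; exact hvC hg
        simp [hy, hg, hgv]
      · by_cases hfg : Φ.graph.Adj f g
        · rw [hy_off g hg, hy₀S g (hSout hf hg hfg)]
          simp
        · simp [hA0 hfg]
    rw [hy₀, Pi.zero_apply] at h1
    rw [eq_neg_of_add_eq_zero_left h1]
    by_cases hfw : f = w
    · rw [if_pos hfw, hfw]
    · rw [if_neg hfw, hA0 fun h => hfw (hwu hf h), neg_zero]
  -- σ is a proper 2-colouring of the forest by signs, so A(σy) = -σ A y on C. Since A y is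
  -- supported at w within C, the combination x is a kernel vector with x w = 2 y w, and row v
  -- forces x w = 0.
  have hyw : y w = 0 := by
    obtain ⟨σ, hσ⟩ := (isAcyclic_offCyclesGraph (G := Φ.graph)).exists_potential
      (fun _ _ => (-1 : ℤˣ)) (by simp)
    have hσ2 : ∀ f, ((σ f : ℤˣ) : ℂ) * (σ f : ℤˣ) = 1 := fun f => by
      rcases Int.units_eq_one_or (σ f) with h | h <;> simp [h]
    let x : V → ℂ := fun f => y f + (σ w : ℤˣ) * ((σ f : ℤˣ) * y f)
    have hx : A.mulVec x = 0 := by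
      refine hsupp x (fun f hf => by simp [x, hy_off f hf]) fun f hf => ?_
      have h1 : A.mulVec x f =
          A.mulVec y f - (σ w : ℤˣ) * ((σ f : ℤˣ) * A.mulVec y f) := by
        simp only [Matrix.mulVec, dotProduct, Finset.mul_sum, ← Finset.sum_sub_distrib]
        refine Finset.sum_congr rfl fun g _ => ?_
        by_cases hg : g ∈ C
        · by_cases hfg : Φ.graph.Adj f g
          · rw [show x g = y g + (σ w : ℤˣ) * ((σ g : ℤˣ) * y g) from rfl,
              hσ f g ⟨hfg, hCU hf, hCU hg⟩]
            push_cast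
            ring
          · simp [hA0 hfg]
        · simp [x, hy_off g hg]
      rw [h1, hyC f hf]
      by_cases hfw : f = w
      · rw [hfw, ← mul_assoc, hσ2, one_mul, sub_self]
      · simp [hfw]
    have h2 : A.mulVec x v = A v w * x w := by
      refine Finset.sum_eq_single w (fun g _ hgw => ?_) (by simp)
      by_cases hg : g ∈ C
      · exact mul_eq_zero_of_left (hA0 fun h => hgw (hwu hg h.symm)) _
      · simp [x, hy_off g hg]
    have h3 : x w = y w + y w := by
      simp only [x]
      rw [← mul_assoc, hσ2, one_mul]
    rw [hx, h3, Pi.zero_apply] at h2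
    rcases mul_eq_zero.1 h2.symm with h | h
    · exact absurd h (Φ.adjMatrix_ne_zero_iff.2 hwv.symm)
    · exact self_eq_neg.1 (eq_neg_of_add_eq_zero_left h)
  have hybd : ∀ f ∈ Φ.graph.cycleBoundary, y f = 0 := by
    rintro f ⟨hfU, O', hO', v', hv', hfv⟩
    by_cases hf : f ∈ C
    · have hv'ρ := hρ' ⟨O', hO'⟩ f hf v' hv' hfv
      have hv'S : v' ∈ Set.range ρ := ⟨_, hv'ρ.symm⟩
      by_cases hvv : v' = v
      · subst hvv
        rw [hwu hf hfv, hyw]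
      -- At another attaching vertex v', pair y₀, which is 0 there, with a kernel vector equal to 1
      -- there.
      · obtain ⟨z, hz, hzS⟩ := hsec v' hv'S
        have hb : Φ.graph.IsBridge s(v', f) :=
          isBridge_of_forall_cycleSet hfv.symm fun O hO _ => hfU O hO
        have hp := Φ.bridge_pairing hfv.symm hb hy₀ hz
        rw [hzS v' hv'S, hy₀S v' hv'S, if_pos rfl, if_neg hvv, star_one, one_mul, mul_zero,
          mul_zero] at hp
        have h0 := (mul_eq_zero.1 hp).resolve_left (Φ.adjMatrix_ne_zero_iff.2 hfv.symm)
        simp [hy, hf, h0]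
    · exact hy_off f hf
  have hAwv : A w v ≠ 0 := Φ.adjMatrix_ne_zero_iff.2 hwv
  refine ⟨(-A w v)⁻¹ • y, fun f hf => ?_, fun f hf => ?_, ?_⟩
  · simp [hy_off f fun h => hf (hCU h)]
  · simp [hybd f hf]
  · ext f
    rw [Matrix.mulVec_smul, Pi.smul_apply, smul_eq_mul, Pi.single_apply]
    by_cases hf : f ∈ C
    · rw [hyC f hf]
      by_cases hfw : f = w
      · rw [if_pos hfw, if_pos hfw, inv_mul_cancel₀ (neg_ne_zero.2 hAwv)]
      · rw [if_neg hfw, if_neg hfw, mul_zero]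
    · have hfw : f ≠ w := by rintro rfl; exact hf hwC
      rw [if_neg hfw]
      convert mul_zero _
      -- A neighbour in C of a vertex outside C is a boundary vertex, where y vanishes.
      refine Finset.sum_eq_zero fun g _ => ?_
      by_cases hg : g ∈ C
      · by_cases hgf : Φ.graph.Adj g f
        · obtain ⟨O', hO', hfO⟩ := notMem_offCycles.1 (hCcl hg hf hgf)
          rw [hybd g ⟨hCU hg, O', hO', f, hfO, hgf⟩, mul_zero]
        · exact mul_eq_zero_of_left (hA0 fun h => hgf h.symm) _
      · rw [hy_off g hg, mul_zero]

/-- The analogue of `exists_solution_offCycles` for the underlying graph. -/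
theorem LowerOptimal.exists_solution_offCycles_graph (hΦ : Φ.LowerOptimal) {w : V}
    (hw : w ∈ Φ.graph.cycleBoundary) :
    ∃ y : V → ℂ, (∀ f ∉ Φ.graph.offCycles, y f = 0) ∧ (∀ f ∈ Φ.graph.cycleBoundary, y f = 0) ∧
      Φ.graph.cAdj.mulVec y = Pi.single w 1 := by
  obtain ⟨y, h1, h2, h3⟩ := hΦ.exists_solution_offCycles hw
  obtain ⟨U, hU0, hU⟩ := Φ.exists_gauge offCyclesGraph_le isAcyclic_offCyclesGraph
  refine ⟨fun f => U w * ((U f)⁻¹ * y f), fun f hf => by simp [h1 f hf],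
    fun f hf => by simp [h2 f hf], ?_⟩
  ext f
  have key : Φ.graph.cAdj.mulVec (fun f => U w * ((U f)⁻¹ * y f)) f =
      U w * ((U f)⁻¹ * Φ.adjMatrix.mulVec y f) := by
    simp only [Matrix.mulVec, dotProduct, Finset.mul_sum]
    refine Finset.sum_congr rfl fun g _ => ?_
    by_cases hfg : Φ.graph.Adj f g
    · by_cases hg : g ∈ Φ.graph.offCycles
      · by_cases hf : f ∈ Φ.graph.offCycles
        · have h := hU f g ⟨hfg, hf, hg⟩
          have hg0 := hU0 g
          have hA0 := Φ.adjMatrix_ne_zero_iff.2 hfg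
          simp only [cAdj, Matrix.of_apply, if_pos hfg, one_mul]
          rw [← h]
          field_simp
        · obtain ⟨O, hO, hfO⟩ := notMem_offCycles.1 hf
          simp [h2 g ⟨hg, O, hO, f, hfO, hfg.symm⟩]
      · simp [h1 g hg]
    · have h0 : Φ.adjMatrix f g = 0 := not_not.1 (mt Φ.adjMatrix_ne_zero_iff.1 hfg)
      simp [cAdj, hfg, h0]
  rw [key, h3, Pi.single_apply]
  by_cases hfw : f = w
  · simp [hfw, hU0]
  · simp [hfw]

end GainGraph

/-! ### Length and gain of a cycle -/

namespace SimpleGraph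

variable {V : Type*} {G : SimpleGraph V}

theorem cAdj_apply_of_not_adj {u v : V} (h : ¬ G.Adj u v) : G.cAdj u v = 0 := by
  simp [cAdj, h]

theorem cAdj_apply_of_adj {u v : V} (h : G.Adj u v) : G.cAdj u v = 1 := by
  simp [cAdj, h]

theorem cAdj_transpose : G.cAdj.transpose = G.cAdj := by
  ext u v
  by_cases h : G.Adj u v
  · simp [cAdj, h, h.symm]
  · simp [cAdj, h, mt G.adj_symm h]

theorem cAdj_mulVec_dotProduct [Fintype V] (x y : V → ℂ) :
    G.cAdj.mulVec x ⬝ᵥ y = x ⬝ᵥ G.cAdj.mulVec y := by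
  rw [Matrix.dotProduct_mulVec, ← Matrix.mulVec_transpose, cAdj_transpose]

end SimpleGraph

namespace GainGraph

open SimpleGraph

variable {V : Type*}

theorem exists_transversal_mem (Φ : GainGraph V) {O : Φ.graph.Subgraph}
    (hO : O ∈ Φ.graph.cycleSet) {v : V} (hv : v ∈ O.verts) :
    ∃ ρ : Φ.graph.cycleSet → V, (∀ O, ρ O ∈ O.1.verts) ∧ ρ ⟨O, hO⟩ = v := by
  classical
  obtain ⟨ρ, hρ⟩ := Φ.exists_transversal
  refine ⟨Function.update ρ ⟨O, hO⟩ v, fun O' => ?_, by simp⟩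
  by_cases h : O' = ⟨O, hO⟩
  · subst h
    simpa using hv
  · simpa [h] using hρ O'

theorem adjMatrix_mul_swap (Φ : GainGraph V) {u v : V} (h : Φ.graph.Adj u v) :
    Φ.adjMatrix u v * Φ.adjMatrix v u = 1 := by
  simp only [adjMatrix, Matrix.of_apply, h, h.symm, dif_pos, Φ.gain_swap h]
  rw [← Circle.coe_mul, mul_inv_cancel, Circle.coe_one]

theorem coe_walkGain (Φ : GainGraph V) {u v : V} (w : Φ.graph.Walk u v) :
    (Φ.walkGain w : ℂ) =
      ∏ k ∈ Finset.range w.length, Φ.adjMatrix (w.getVert k) (w.getVert (k + 1)) := by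
  induction w with
  | nil => simp [walkGain]
  | cons h p ih =>
    rw [Walk.length_cons, Finset.prod_range_succ']
    simp only [Walk.getVert_cons_succ, Walk.getVert_zero]
    rw [← ih]
    simp [walkGain, adjMatrix, h, mul_comm]

variable [Fintype V] [DecidableEq V] {Φ : GainGraph V}

/-- A chord would lie on a second cycle meeting O. -/
theorem LowerOptimal.adj_of_mem_verts (hΦ : Φ.LowerOptimal) {O : Φ.graph.Subgraph}
    (hO : O ∈ Φ.graph.cycleSet) {u v : V} (hu : u ∈ O.verts) (hv : v ∈ O.verts)
    (h : Φ.graph.Adj u v) : O.Adj u v := by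
  by_contra hn
  have hr : (Φ.graph.deleteEdges {s(u, v)}).Reachable u v := by
    refine mem_verts_of_reachable (connected_of_mem_cycleSet hO)
      (X := {x | (Φ.graph.deleteEdges {s(u, v)}).Reachable u x}) hu (Reachable.refl _)
      (fun a ha b hab => Reachable.trans ha (Adj.reachable ?_)) hv
    rw [deleteEdges_adj]
    refine ⟨hab.adj_sub, fun h' => hn ?_⟩
    rw [← Subgraph.mem_edgeSet, ← (Set.mem_singleton_iff.1 h')]
    exact hab
  obtain ⟨O', hO', huv⟩ := exists_mem_cycleSet_of_reachable_deleteEdges h hr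
  exact hn (hΦ.eq_of_mem_verts hO' hO huv.fst_mem hu ▸ huv)

/-- On a cycle, a vector vanishing on the boundary only sees the edges of the cycle. -/
theorem LowerOptimal.mulVec_apply_of_neighborSet (hΦ : Φ.LowerOptimal) {M : Matrix V V ℂ}
    (hM : ∀ u v, ¬ Φ.graph.Adj u v → M u v = 0) {x : V → ℂ}
    (hx : ∀ f ∈ Φ.graph.cycleBoundary, x f = 0) {O : Φ.graph.Subgraph}
    (hO : O ∈ Φ.graph.cycleSet) {v a b : V} (hv : v ∈ O.verts) (hab : a ≠ b)
    (hn : O.neighborSet v = {a, b}) : M.mulVec x v = M v a * x a + M v b * x b := by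
  rw [Matrix.mulVec, dotProduct, ← Finset.sum_pair (f := fun g => M v g * x g) hab]
  refine (Finset.sum_subset (Finset.subset_univ _) fun g _ hg => ?_).symm
  by_cases hvg : Φ.graph.Adj v g
  · by_cases hgU : g ∈ Φ.graph.offCycles
    · rw [hx g ⟨hgU, O, hO, v, hv, hvg.symm⟩, mul_zero]
    · obtain ⟨O', hO', hgO⟩ := notMem_offCycles.1 hgU
      have : O = O' := by
        by_contra hne
        exact hΦ.not_adj_of_ne hO hO' hne hv hgO hvg
      subst this
      have h : g ∈ O.neighborSet v := hΦ.adj_of_mem_verts hO hv hgO hvg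
      rw [hn] at h
      exact absurd (by simpa using h) hg
  · rw [hM v g hvg, zero_mul]

/-- Pair y with the solution z of A z = e_w and use Hermitian symmetry. -/
theorem LowerOptimal.ker_vanish_cycleBoundary (hΦ : Φ.LowerOptimal) {y : V → ℂ}
    (hy : Φ.adjMatrix.mulVec y = 0) {w : V} (hw : w ∈ Φ.graph.cycleBoundary) : y w = 0 := by
  obtain ⟨z, -, -, hz⟩ := hΦ.exists_solution_offCycles hw
  have h1 := Φ.adjMatrix.star_mulVec z
  rw [Φ.adjMatrix_isHermitian.eq, hz] at h1
  have h2 : star z ⬝ᵥ Φ.adjMatrix.mulVec y = star (Pi.single w 1) ⬝ᵥ y := by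
    rw [Matrix.dotProduct_mulVec, h1]
  rw [hy, dotProduct_zero, ← Pi.single_star, star_one, single_one_dotProduct] at h2
  exact h2.symm

theorem LowerOptimal.vanish_cycleBoundary_of_graph (hΦ : Φ.LowerOptimal) {x : V → ℂ}
    (hx : ∀ f ∈ Φ.graph.offCycles, Φ.graph.cAdj.mulVec x f = 0) {w : V}
    (hw : w ∈ Φ.graph.cycleBoundary) : x w = 0 := by
  obtain ⟨y, hyU, -, hy⟩ := hΦ.exists_solution_offCycles_graph hw
  have h := Φ.graph.cAdj_mulVec_dotProduct x y
  rw [hy, dotProduct_single_one] at h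
  rw [← h]
  refine Finset.sum_eq_zero fun f _ => ?_
  by_cases hf : f ∈ Φ.graph.offCycles
  · rw [hx f hf, zero_mul]
  · rw [hyU f hf, mul_zero]

/-- Some x has A(G) x = e_v and x v = 0. Around the cycle X (i + 2) = -X i, with closing condition X
1 + X (p - 1) = 1 at v. -/
theorem LowerOptimal.length_modEq (hΦ : Φ.LowerOptimal) {v : V} (w : Φ.graph.Walk v v)
    (hw : w.IsCycle) : w.length ≡ 2 [MOD 4] := by
  have hO : w.toSubgraph ∈ Φ.graph.cycleSet := ⟨v, w, hw, rfl⟩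
  have hv : v ∈ w.toSubgraph.verts := by simp
  obtain ⟨ρ, hρ, hρv⟩ := Φ.exists_transversal_mem hO hv
  obtain ⟨-, -, h⟩ := hΦ.of_transversal ρ hρ
  obtain ⟨x, hx, hxS⟩ := h v ⟨_, hρv⟩
  have hxv : x v = 0 := hxS v ⟨_, hρv⟩
  have hxb : ∀ f ∈ Φ.graph.cycleBoundary, x f = 0 := fun f hf =>
    hΦ.vanish_cycleBoundary_of_graph (fun g hg => by
      rw [hx, Pi.single_eq_of_ne]
      rintro rfl
      exact hg _ hO hv) hf
  have h3 := hw.three_le_length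
  set X : ℕ → ℂ := fun i => x (w.getVert i) with hX
  have hX0 : X 0 = 0 := by simp [hX, hxv]
  have hXp : X w.length = 0 := by simp [hX, hxv]
  have hstep : ∀ i, i + 2 ≤ w.length → X (i + 2) = -X i := by
    intro i hi
    have hn := hw.neighborSet_toSubgraph_internal (i := i + 1) (by omega) (by omega)
    have hne := hw.getVert_sub_one_ne_getVert_add_one (i := i + 1) (by omega)
    have hadj : Φ.graph.Adj (w.getVert i) (w.getVert (i + 1)) := w.adj_getVert_succ (by omega)
    have hadj' : Φ.graph.Adj (w.getVert (i + 1)) (w.getVert (i + 2)) :=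
      w.adj_getVert_succ (by omega)
    have h := hΦ.mulVec_apply_of_neighborSet (fun _ _ => cAdj_apply_of_not_adj) hxb hO
      (by simp) hne hn
    have hvne : w.getVert (i + 1) ≠ v := by
      intro h
      have := (hw.getVert_endpoint_iff (by omega)).1 h
      omega
    rw [hx, Pi.single_eq_of_ne hvne, add_tsub_cancel_right, cAdj_apply_of_adj hadj.symm,
      cAdj_apply_of_adj hadj', one_mul, one_mul] at h
    exact eq_neg_of_add_eq_zero_right h.symm
  have hend : X 1 + X (w.length - 1) = 1 := by
    have hn := hw.neighborSet_toSubgraph_endpoint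
    have h := hΦ.mulVec_apply_of_neighborSet (fun _ _ => cAdj_apply_of_not_adj) hxb hO
      hv hw.snd_ne_penultimate hn
    rw [hx, Pi.single_eq_same, cAdj_apply_of_adj (w.adj_snd hw.not_nil),
      cAdj_apply_of_adj (w.adj_penultimate hw.not_nil).symm, one_mul, one_mul] at h
    exact h.symm
  have heven : ∀ j, 2 * j ≤ w.length → X (2 * j) = 0 := by
    intro j
    induction j with
    | zero => exact fun _ => hX0
    | succ j ih =>
      intro hj
      rw [mul_add, mul_one, hstep _ (by omega), ih (by omega), neg_zero]
  have hodd : ∀ j, 2 * j + 1 ≤ w.length → X (2 * j + 1) = (-1) ^ j * X 1 := by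
    intro j
    induction j with
    | zero => intro _; simp
    | succ j ih =>
      intro hj
      rw [show 2 * (j + 1) + 1 = 2 * j + 1 + 2 by ring, hstep _ (by omega), ih (by omega), pow_succ]
      ring
  -- If 4 divides p then X (p - 1) = -X 1; if p is odd then X p = 0 gives X 1 = 0, while p - 1 is
  -- even. Both contradict the closing condition.
  rcases Nat.even_or_odd' w.length with ⟨m, hm | hm⟩
  · rcases Nat.even_or_odd m with hm' | hm'
    · have h := hodd (m - 1) (by omega)
      have hm1 : Odd (m - 1) := by
        obtain ⟨k, hk⟩ := hm'
        exact ⟨k - 1, by omega⟩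
      rw [hm1.neg_one_pow, show 2 * (m - 1) + 1 = w.length - 1 by omega] at h
      rw [h] at hend
      simp at hend
    · obtain ⟨k, hk⟩ := hm'
      rw [hm, hk, Nat.ModEq]
      omega
  · have h := hodd m (by omega)
    have h' := heven m (by omega)
    rw [← hm, hXp] at h
    rw [show 2 * m = w.length - 1 by omega] at h'
    have h1 : X 1 = 0 := (mul_eq_zero.1 h.symm).resolve_left (by simp)
    rw [h', h1] at hend
    simp at hend

/-- A kernel vector with value 1 at v changes sign over every two edges after multiplication by
their gains; going once around returns to the value 1. -/
theorem LowerOptimal.isTypeA (hΦ : Φ.LowerOptimal) {v : V} (w : Φ.graph.Walk v v)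
    (hw : w.IsCycle) : Φ.IsTypeA w := by
  have hmod := hΦ.length_modEq w hw
  have hO : w.toSubgraph ∈ Φ.graph.cycleSet := ⟨v, w, hw, rfl⟩
  have hv : v ∈ w.toSubgraph.verts := by simp
  obtain ⟨ρ, hρ, hρv⟩ := Φ.exists_transversal_mem hO hv
  obtain ⟨⟨-, h⟩, -⟩ := hΦ.of_transversal ρ hρ
  obtain ⟨y, hy, hyS⟩ := h v ⟨_, hρv⟩
  have hyv : y v = 1 := by simpa using hyS v ⟨_, hρv⟩
  set Y : ℕ → ℂ := fun i => y (w.getVert i) with hY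
  have hstep : ∀ i, i + 2 ≤ w.length →
      Φ.adjMatrix (w.getVert i) (w.getVert (i + 1)) *
        (Φ.adjMatrix (w.getVert (i + 1)) (w.getVert (i + 2)) * Y (i + 2)) = -Y i := by
    intro i hi
    have hn := hw.neighborSet_toSubgraph_internal (i := i + 1) (by omega) (by omega)
    have hne := hw.getVert_sub_one_ne_getVert_add_one (i := i + 1) (by omega)
    have hadj : Φ.graph.Adj (w.getVert i) (w.getVert (i + 1)) := w.adj_getVert_succ (by omega)
    have h := hΦ.mulVec_apply_of_neighborSet
      (fun _ _ hn => not_not.1 (mt Φ.adjMatrix_ne_zero_iff.1 hn))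
      (fun f hf => hΦ.ker_vanish_cycleBoundary hy hf) hO (by simp) hne hn
    rw [hy, Pi.zero_apply, add_tsub_cancel_right] at h
    rw [eq_neg_of_add_eq_zero_right h.symm, mul_neg, ← mul_assoc, Φ.adjMatrix_mul_swap hadj,
      one_mul]
  have hprod : ∀ j, 2 * j ≤ w.length →
      (∏ k ∈ Finset.range (2 * j), Φ.adjMatrix (w.getVert k) (w.getVert (k + 1))) * Y (2 * j) =
        (-1) ^ j := by
    intro j
    induction j with
    | zero => intro _; simp [hY, hyv]
    | succ j ih =>
      intro hj
      rw [mul_add, mul_one, Finset.prod_range_succ, Finset.prod_range_succ, mul_assoc, mul_assoc,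
        hstep _ (by omega), mul_neg, ih (by omega), pow_succ, mul_neg_one]
  have heven : Even w.length := by
    rw [Nat.even_iff]
    have : w.length % 4 = 2 := hmod
    omega
  refine ⟨heven, ?_⟩
  have h2 : 2 * (w.length / 2) = w.length := Nat.two_mul_div_two_of_even heven
  have h := hprod (w.length / 2) h2.le
  rw [h2, ← Φ.coe_walkGain] at h
  simpa [hY, hyv] using h

end GainGraph

/-! ### Ranks of the contracted graph and of its off-cycle part -/

namespace SimpleGraph

variable {V : Type*}

/-- Away from the contracted cycles, `contractCycles` is the induced subgraph off the cycles. -/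
noncomputable def induceOffCyclesIso (G : SimpleGraph V) :
    G.induce G.offCycles ≃g G.contractCyclesDelete where
  toEquiv := Equiv.ofBijective
    (fun u => ⟨Sum.inl u, by rintro ⟨O, hO⟩; cases hO⟩) (by
      constructor
      · intro u v h
        exact Sum.inl_injective (congrArg Subtype.val h)
      · rintro ⟨u | O, h⟩
        · exact ⟨u, rfl⟩
        · exact absurd ⟨O, rfl⟩ h)
  map_rel_iff' := Iff.rfl

/-- Extension by zero of a vector on the vertices off the cycles. -/
noncomputable def extendOffCycles (G : SimpleGraph V) (x : G.offCycles ⊕ G.cycleSet → ℂ) :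
    V → ℂ :=
  fun f => open Classical in if h : f ∈ G.offCycles then x (Sum.inl ⟨f, h⟩) else 0

theorem cAdj_mulVec_extendOffCycles [Fintype V] (G : SimpleGraph V)
    [Fintype G.offCycles] [Fintype G.cycleSet] {x : G.offCycles ⊕ G.cycleSet → ℂ}
    (hx : ∀ O, x (Sum.inr O) = 0) (u : G.offCycles) :
    G.cAdj.mulVec (G.extendOffCycles x) u = G.contractCycles.cAdj.mulVec x (Sum.inl u) := by
  classical
  have h0 : ∀ v ∉ G.offCycles, G.extendOffCycles x v = 0 := fun v hv => by
    simp [extendOffCycles, hv]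
  rw [← G.cAdj.submatrix_mulVec_restrict h0 u, Matrix.mulVec, Matrix.mulVec, dotProduct,
    dotProduct, Fintype.sum_sum_type]
  simp only [hx, mul_zero, Finset.sum_const_zero, add_zero]
  refine Finset.sum_congr rfl fun v _ => congrArg₂ _ ?_ ?_
  · by_cases h : G.Adj u v
    · rw [Matrix.submatrix_apply, cAdj_apply_of_adj h]
      exact (cAdj_apply_of_adj (G := G.contractCycles) (u := Sum.inl u) (v := Sum.inl v) h).symm
    · rw [Matrix.submatrix_apply, cAdj_apply_of_not_adj h]
      exact (cAdj_apply_of_not_adj (G := G.contractCycles) (u := Sum.inl u) (v := Sum.inl v)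
        h).symm
  · simp [extendOffCycles]

end SimpleGraph

namespace GainGraph

open SimpleGraph

variable {V : Type*} [Fintype V] [DecidableEq V] {Φ : GainGraph V}

/-- Every cycle vertex lies on a transversal, so kernel vectors of G vanish on the cycles.
Conversely, vectors annihilated off the cycles vanish at the boundary, so the rows at cycle vertices
hold automatically. -/
theorem LowerOptimal.localKer_univ_eq (hΦ : Φ.LowerOptimal) :
    Φ.graph.cAdj.localKer Set.univ = Φ.graph.cAdj.localKer Φ.graph.offCycles := by
  ext x
  constructor
  · intro hx
    refine ⟨fun v hv => ?_, fun v _ => hx.2 v trivial⟩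
    obtain ⟨O, hO, hvO⟩ := notMem_offCycles.1 hv
    obtain ⟨ρ, hρ, hρv⟩ := Φ.exists_transversal_mem hO hvO
    obtain ⟨-, h, -⟩ := hΦ.of_transversal ρ hρ
    exact h x (Matrix.mem_localKer_univ.1 hx) v ⟨_, hρv⟩
  · intro hx
    refine ⟨by simp, fun v _ => ?_⟩
    by_cases hv : v ∈ Φ.graph.offCycles
    · exact hx.2 v hv
    · obtain ⟨O, hO, hvO⟩ := notMem_offCycles.1 hv
      refine Finset.sum_eq_zero fun g _ => ?_
      by_cases hg : g ∈ Φ.graph.offCycles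
      · by_cases hvg : Φ.graph.Adj v g
        · exact mul_eq_zero_of_right _ (hΦ.vanish_cycleBoundary_of_graph hx.2
            ⟨hg, O, hO, v, hvO, hvg.symm⟩)
        · exact mul_eq_zero_of_left (cAdj_apply_of_not_adj hvg) _
      · exact mul_eq_zero_of_right _ (hx.1 g hg)

theorem LowerOptimal.finsum_ncard_verts (hΦ : Φ.LowerOptimal) :
    ∑ᶠ O ∈ Φ.graph.cycleSet, O.verts.ncard = Φ.graph.offCyclesᶜ.ncard := by
  have h : Φ.graph.offCyclesᶜ = ⋃ O ∈ Φ.graph.cycleSet, O.verts := by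
    ext v
    rw [Set.mem_compl_iff, notMem_offCycles]
    simp
  rw [h, (Set.toFinite _).ncard_biUnion (fun _ _ => Set.toFinite _) fun O₁ h₁ O₂ h₂ hne =>
    hΦ.disjoint_verts h₁ h₂ hne]

theorem LowerOptimal.adjRank_eq (hΦ : Φ.LowerOptimal) :
    Φ.graph.adjRank =
      Φ.graph.contractCyclesDelete.adjRank + ∑ᶠ O ∈ Φ.graph.cycleSet, O.verts.ncard := by
  have h1 := Φ.graph.adjRank_add_finrank
  have h2 := Φ.graph.adjRank_induce_add_finrank Φ.graph.offCycles
  have h3 := Set.ncard_add_ncard_compl Φ.graph.offCycles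
  rw [hΦ.localKer_univ_eq] at h1
  rw [← adjRank_congr Φ.graph.induceOffCyclesIso, hΦ.finsum_ncard_verts]
  omega

/-- Adding the vertices t_O to Γ_G raises the nullity by exactly their number, so the rank does not
change. -/
theorem LowerOptimal.adjRank_contractCycles (hΦ : Φ.LowerOptimal) :
    Φ.graph.contractCycles.adjRank = Φ.graph.contractCyclesDelete.adjRank := by
  classical
  set G := Φ.graph with hG
  have := Fintype.ofFinite G.offCycles
  have := Fintype.ofFinite G.cycleSet
  set T := G.contractCycles with hT
  have h1 := T.adjRank_add_finrank
  have h2 := T.adjRank_induce_add_finrank G.contractedVertsᶜ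
  have h3 := Set.ncard_add_ncard_compl G.contractedVerts
  have hlift : ∀ {x : G.offCycles ⊕ G.cycleSet → ℂ}, (∀ O, x (Sum.inr O) = 0) →
      (∀ u : G.offCycles, (u : V) ∈ G.cycleBoundary → x (Sum.inl u) = 0) →
      ∀ O, T.cAdj.mulVec x (Sum.inr O) = 0 := by
    intro x hx hx' O
    refine Finset.sum_eq_zero fun a _ => ?_
    rcases a with u | O'
    · by_cases hadj : T.Adj (Sum.inr O) (Sum.inl u)
      · obtain ⟨v, hv, huv⟩ := hadj
        exact mul_eq_zero_of_right _ (hx' u ⟨u.2, O.1, O.2, v, hv, huv⟩)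
      · exact mul_eq_zero_of_left (cAdj_apply_of_not_adj hadj) _
    · exact mul_eq_zero_of_right _ (hx O')
  have h4 := T.cAdj.finrank_localKer_univ_eq G.contractedVerts (by
    intro x hx
    have hx0 : ∀ O, x (Sum.inr O) = 0 := fun O => hx.1 _ (by simp [contractedVerts])
    have hxi : ∀ u : G.offCycles, T.cAdj.mulVec x (Sum.inl u) = 0 := fun u =>
      hx.2 _ (by simp [contractedVerts])
    ext a
    rcases a with u | O
    · exact hxi u
    · refine hlift hx0 (fun u hu => ?_) O
      have h := hΦ.vanish_cycleBoundary_of_graph (x := G.extendOffCycles x) (fun f hf => by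
        rw [G.cAdj_mulVec_extendOffCycles hx0 ⟨f, hf⟩, hxi]) hu
      simpa [extendOffCycles, u.2] using h) (by
    rintro _ ⟨O, rfl⟩
    have hsol : ∀ u : G.offCycles, ∃ y : G.offCycles ⊕ G.cycleSet → ℂ, (∀ O, y (Sum.inr O) = 0) ∧
        ((u : V) ∈ G.cycleBoundary → T.cAdj.mulVec y = Pi.single (Sum.inl u) 1) := by
      intro u
      by_cases hu : (u : V) ∈ G.cycleBoundary
      · obtain ⟨y, hyU, hyb, hy⟩ := hΦ.exists_solution_offCycles_graph hu
        let y' : G.offCycles ⊕ G.cycleSet → ℂ := Sum.elim (fun u => y u) fun _ => 0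
        have hy' : G.extendOffCycles y' = y := by
          ext f
          by_cases hf : f ∈ G.offCycles
          · simp [extendOffCycles, hf, y']
          · simp [extendOffCycles, hf, hyU f hf]
        refine ⟨y', fun O => rfl, fun _ => ?_⟩
        ext a
        rcases a with f | O
        · rw [← G.cAdj_mulVec_extendOffCycles (fun O => rfl) f, hy', hy]
          simp [Pi.single_apply, Subtype.ext_iff]
        · rw [hlift (fun O => rfl) (fun u hu => hyb u hu), Pi.single_eq_of_ne (by simp)]
      · exact ⟨0, fun _ => rfl, fun h => absurd h hu⟩
    choose y hy0 hy using hsol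
    -- The image of e_{t_O} is the sum of e_u over the neighbours u of t_O, all off-cycle boundary
    -- vertices; subtracting their solutions y u cancels it and leaves the entries at the t's
    -- untouched.
    refine ⟨Pi.single (Sum.inr O) 1 -
      ∑ u : G.offCycles, T.cAdj (Sum.inr O) (Sum.inl u) • y u, ?_, ?_⟩
    · rw [Matrix.mulVec_sub, Matrix.mulVec_sum]
      have hterm : ∀ u : G.offCycles, T.cAdj.mulVec (T.cAdj (Sum.inr O) (Sum.inl u) • y u) =
          T.cAdj (Sum.inr O) (Sum.inl u) • Pi.single (Sum.inl u) 1 := by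
        intro u
        by_cases hadj : T.Adj (Sum.inr O) (Sum.inl u)
        · obtain ⟨v, hv, huv⟩ := id hadj
          rw [Matrix.mulVec_smul, hy u ⟨u.2, O.1, O.2, v, hv, huv⟩]
        · rw [cAdj_apply_of_not_adj hadj, zero_smul, zero_smul, Matrix.mulVec_zero]
      simp only [hterm]
      ext a
      rw [Pi.sub_apply, Finset.sum_apply, Matrix.mulVec_single_one, Pi.zero_apply, Matrix.col_apply]
      rcases a with f | O'
      · have hsymm := congrFun (congrFun (cAdj_transpose (G := T)) (Sum.inl f)) (Sum.inr O)
        rw [Matrix.transpose_apply] at hsymm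
        rw [← hsymm]
        simp [Pi.single_apply]
      · have hn : ¬ T.Adj (Sum.inr O') (Sum.inr O) := by
          rintro ⟨hne, v, hv, u, hu, hvu⟩
          exact hΦ.not_adj_of_ne O'.2 O.2 (fun h => hne (Subtype.ext h)) hv hu hvu
        rw [cAdj_apply_of_not_adj hn]
        simp
    · rintro _ ⟨O', rfl⟩
      rw [Pi.sub_apply, Finset.sum_apply]
      simp [hy0, Pi.single_apply])
  have h5 : G.contractCyclesDelete = T.induce G.contractedVertsᶜ := rfl
  rw [h5]
  omega

end GainGraph

theorem theorem4p6 {V : Type*} [Finite V] (Φ : GainGraph V) (hΦ : Φ.LowerOptimal) :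
    (∀ O₁ ∈ Φ.graph.cycleSet, ∀ O₂ ∈ Φ.graph.cycleSet, O₁ ≠ O₂ → Disjoint O₁.verts O₂.verts) ∧
    (∀ (v : V) (w : Φ.graph.Walk v v), w.IsCycle → Φ.IsTypeA w ∧ w.length ≡ 2 [MOD 4]) ∧
    Φ.graph.adjRank =
      Φ.graph.contractCycles.adjRank + ∑ᶠ O ∈ Φ.graph.cycleSet, O.verts.ncard ∧
    Φ.graph.contractCycles.adjRank = Φ.graph.contractCyclesDelete.adjRank := by
  classical
  have := Fintype.ofFinite V
  refine ⟨fun O₁ h₁ O₂ h₂ hne => hΦ.disjoint_verts h₁ h₂ hne,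
    fun v w hw => ⟨hΦ.isTypeA w hw, hΦ.length_modEq w hw⟩, ?_, hΦ.adjRank_contractCycles⟩
  rw [hΦ.adjRank_contractCycles]
  exact hΦ.adjRank_eq
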